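/- **Theorem 4.2 (Willmore-type theorem).** Let $\|\cdot\|$ be a norm on $\mathbb{R}^3$ that is smooth away from the origin and strictly convex, and whose unit sphere $\partial B=\{x:\|x\|=1\}$ has nowhere vanishing (usual) Gaussian curvature. Let $M\subset\mathbb{R}^3$ be a nonempty closed (that is, compact and without boundary) smooth embedded surface, and let $\eta:M\to\partial B$ be a Birkhoff–Gauss map of $M$, i.e. a continuous map such that $\eta(p)$ is Birkhoff orthogonal to $T_pM$ for every $p\in M$: $\|\eta(p)\|\le\|\eta(p)+tw\|$ for all $w\in T_pM$ and $t\in\mathbb{R}$. Let $H(p)=\tfrac12\operatorname{tr}(d\eta_p)$, where $d\eta_p:T_pM\to T_pM$, be the Minkowski mean curvature, and let $\omega(X,Y)=\det(X,Y,\eta)$, taken positive, be the area element of $M$. Let $\lambda(\partial B)=\int_{\partial B}\omega$ be the area of $\partial B$ with respect to the area element defined in the same way by its own Birkhoff–Gauss map (the identity). Then $\int_M H^2\,\omega$ is finite and $$\int_M H^2\,\omega\ \ge\ \lambda(\partial B).$$ Equality holds if and only if $M$ is a Minkowski sphere, i.e. $M=\{x\in\mathbb{R}^3:\|x-c\|=r\}$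 for some $c\in\mathbb{R}^3$ and $r>0$. -/

import Mathlib

open MeasureTheory
open scoped ContDiff ENNReal

noncomputable section

namespace MinkowskiGeometry

/-- The space `ℝ³` with its standard inner product, determinant and Lebesgue measure. -/
abbrev E3 : Type := EuclideanSpace ℝ (Fin 3)

/-- The usual determinant of three vectors of `ℝ³`. -/
def det3 (X Y Z : E3) : ℝ := Matrix.det (Matrix.of fun i j : Fin 3 => (![X, Y, Z] i) j)

/-! ### Embedded surfaces -/

/-- A smooth local parametrization of a set `M ⊆ ℝ³`: a homeomorphism `φ` of an open set
`φ.source` of the `(u, v)`-plane onto a relatively open subset of `M` which, as a map into `ℝ³`,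
is smooth and has injective differential. -/
structure IsLocalParam {M : Set E3} (φ : OpenPartialHomeomorph (ℝ × ℝ) M) : Prop where
  smooth : ContDiffOn ℝ ∞ (fun x => (φ x : E3)) φ.source
  regular : ∀ x ∈ φ.source, Function.Injective (fderiv ℝ (fun x => (φ x : E3)) x)

/-- A closed embedded surface in `ℝ³`: a nonempty compact set that has a smooth local
parametrization around each of its points (in particular it has no boundary). -/
structure IsClosedSurface (M : Set E3) : Prop where
  nonempty : M.Nonempty
  isCompact : IsCompact M
  exists_param : ∀ p : M, ∃ φ : OpenPartialHomeomorph (ℝ × ℝ) M, IsLocalParam φ ∧ p ∈ φ.target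

/-- The tangent plane `T_pM`, as a linear subspace of `ℝ³`. For a surface the tangent cone is
already a linear subspace. -/
def tangentPlane (M : Set E3) (p : E3) : Submodule ℝ E3 :=
  Submodule.span ℝ (tangentConeAt ℝ M p)

open Classical in
/-- The differential `dν_p` at `p` of a map `ν` on `M`, as an endomorphism of `T_pM`.
For the normal maps considered below `dν_p` sends `T_pM` to itself; the value is `0` otherwise.
Only the restriction of `ν` to `M` matters, since a derivative within `M` is uniquely
determined on `T_pM`. -/
def normalDifferential (M : Set E3) (ν : E3 → E3) (p : E3) :
    tangentPlane M p →ₗ[ℝ] tangentPlane M p :=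
  if h : ∀ v ∈ tangentPlane M p,
      (fderivWithin ℝ ν M p : E3 →ₗ[ℝ] E3) v ∈ tangentPlane M p then
    (fderivWithin ℝ ν M p : E3 →ₗ[ℝ] E3).restrict h
  else 0

/-- The Gaussian curvature `K(p) = det(dν_p)` of `M` with respect to the normal map `ν`. -/
def gaussianCurvature (M : Set E3) (ν : E3 → E3) (p : E3) : ℝ :=
  LinearMap.det (normalDifferential M ν p)

/-- The mean curvature `H(p) = tr(dν_p) / 2` of `M` with respect to the normal map `ν`. -/
def meanCurvature (M : Set E3) (ν : E3 → E3) (p : E3) : ℝ :=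
  (1 / 2) * LinearMap.trace ℝ (tangentPlane M p) (normalDifferential M ν p)

/-- The measure on the part of `M` covered by a local parametrization `φ` that is given by the
area element `ω(X, Y) = det(X, Y, η)`: the image under `φ` of the measure
`|det(φ_u, φ_v, η ∘ φ)| du dv`. -/
def patchMeasure {M : Set E3} (η : E3 → E3) (φ : OpenPartialHomeomorph (ℝ × ℝ) M) : Measure E3 :=
  ((volume.restrict φ.source).withDensity fun x =>
    ENNReal.ofReal |det3 (fderiv ℝ (fun y => (φ y : E3)) x (1, 0))
      (fderiv ℝ (fun y => (φ y : E3)) x (0, 1)) (η (φ x))|).map (fun x => (φ x : E3))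

/-- The measure on `M` given by the area element `ω(X, Y) = det(X, Y, η)`. By the change of
variables formula the measures of any two patches agree where the patches overlap, so their
supremum is the measure that glues them together: it restricts to `patchMeasure η φ` on the image
of each local parametrization `φ`. -/
def areaMeasure (M : Set E3) (η : E3 → E3) : Measure E3 :=
  ⨆ (φ : OpenPartialHomeomorph (ℝ × ℝ) M) (_ : IsLocalParam φ), patchMeasure η φ

/-! ### Norms on `ℝ³` -/

/-- The unit sphere `∂B` of the norm `N`. -/
def unitSphere (N : Seminorm ℝ E3) : Set E3 := {x | N x = 1}

/-- The usual (Euclidean) outward unit normal of the level sets of `N`. -/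
def euclideanNormal (N : Seminorm ℝ E3) (x : E3) : E3 := ‖gradient N x‖⁻¹ • gradient N x

/-- `N` is a norm on `ℝ³` which is smooth and strictly convex, and the usual Gaussian curvature of
its unit sphere does not vanish anywhere. -/
structure IsMinkowskiNorm (N : Seminorm ℝ E3) : Prop where
  eq_zero : ∀ x, N x = 0 → x = 0
  smooth : ContDiffOn ℝ ∞ N {0}ᶜ
  strictConvex : StrictConvex ℝ {x : E3 | N x ≤ 1}
  curvature_ne_zero : ∀ x ∈ unitSphere N,
    gaussianCurvature (unitSphere N) (euclideanNormal N) x ≠ 0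

/-- The vector `v` is Birkhoff orthogonal to the plane `P` with respect to `N`. -/
def BirkhoffOrthogonal (N : Seminorm ℝ E3) (v : E3) (P : Submodule ℝ E3) : Prop :=
  ∀ w ∈ P, ∀ t : ℝ, N v ≤ N (v + t • w)

/-- `η` is a Birkhoff-Gauss map of the surface `M`: a continuous field along `M` of vectors of unit
norm which are Birkhoff orthogonal to the tangent planes. The continuous choice
between `η` and `-η` amounts to an orientation of `M`. -/
structure IsBirkhoffGaussMap (N : Seminorm ℝ E3) (M : Set E3) (η : E3 → E3) : Prop where
  continuousOn : ContinuousOn η M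
  norm_eq_one : ∀ p ∈ M, N (η p) = 1
  orthogonal : ∀ p ∈ M, BirkhoffOrthogonal N (η p) (tangentPlane M p)

/-- `M` is a sphere of the norm `N`, with some center `c` and radius `r > 0`. -/
def IsMinkowskiSphere (N : Seminorm ℝ E3) (M : Set E3) : Prop :=
  ∃ (c : E3) (r : ℝ), 0 < r ∧ M = {x | N (x - c) = r}

/-- The area `λ(∂B)` of the unit sphere with respect to the area element of its own
Birkhoff-Gauss map, which is the identity (see `isBirkhoffGaussMap_id`). -/
def unitSphereArea (N : Seminorm ℝ E3) : ℝ≥0∞ := areaMeasure (unitSphere N) id Set.univ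

theorem isBirkhoffGaussMap_id {N : Seminorm ℝ E3} (hN : IsMinkowskiNorm N) :
    IsBirkhoffGaussMap N (unitSphere N) id where
  continuousOn := continuousOn_id
  norm_eq_one := fun p hp => hp
  orthogonal := by
    intro p hp w hw t
    have hp1 : N p = 1 := hp
    have hp0 : p ≠ 0 := by
      rintro rfl
      simp at hp1
    have hd : DifferentiableAt ℝ N p :=
      (hN.smooth.contDiffAt (isOpen_compl_singleton.mem_nhds hp0)).differentiableAt (by simp)
    -- The differential of `N` vanishes on the tangent plane.
    have hker : fderiv ℝ N p w = 0 := by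
      have hle : tangentPlane (unitSphere N) p ≤
          LinearMap.ker (fderiv ℝ N p : E3 →ₗ[ℝ] ℝ) := by
        refine Submodule.span_le.2 fun y hy => ?_
        have h1 : HasFDerivWithinAt N (fderiv ℝ N p) (unitSphere N) p :=
          hd.hasFDerivAt.hasFDerivWithinAt
        have h2 : HasFDerivWithinAt N (0 : E3 →L[ℝ] ℝ) (unitSphere N) p :=
          (hasFDerivWithinAt_const (1 : ℝ) p (unitSphere N)).congr (fun x hx => hx) hp
        exact h1.unique_on h2 hy
      exact hle hw
    -- Convexity along the line through `p` in the direction `w`.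
    set g : ℝ → ℝ := fun s => N (p + s • w) with hg
    have hgc : ConvexOn ℝ Set.univ g := by
      have h := N.convexOn.comp_affineMap (AffineMap.lineMap p (p + w))
      refine h.congr fun s _ => ?_
      simp [hg, AffineMap.lineMap_apply, add_comm]
    have hgd : HasDerivAt g 0 0 := by
      have hl : HasDerivAt (fun s : ℝ => p + s • w) w 0 := by
        simpa using ((hasDerivAt_id (0 : ℝ)).smul_const w).const_add p
      have h := HasFDerivAt.comp_hasDerivAt (f := fun s : ℝ => p + s • w) (0 : ℝ)
        (by simpa using hd.hasFDerivAt) hl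
      simpa [hker, hg, Function.comp_def] using h
    have hmin : IsMinOn g Set.univ 0 := by
      refine hgc.isMinOn_of_rightDeriv_eq_zero (by simp) ?_
      exact (hgd.hasDerivWithinAt).derivWithin (uniqueDiffWithinAt_Ioi 0)
    have := hmin (Set.mem_univ t)
    simpa [hg] using this

end MinkowskiGeometry

end

open MinkowskiGeometry

open Topology Filter

noncomputable section

namespace MinkowskiGeometry

/-! ### First and second derivatives of the norm -/

section Norm

variable {N : Seminorm ℝ E3}

/-! Write `dN_v` for the differential of the norm at `v`, `ω` for the area element and `K` for the
determinant of `dη`. The functional `dN_{η(p)}` is the conormal of `M` at `p`: it kills `T_pM` and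
takes the value 1 on `η(p)`. Differentiating these relations shows that `dη_p` preserves `T_pM` and
is self-adjoint for the Hessian of `N` at `η(p)`. This Hessian is positive definite on `T_pM`,
because `∂B` has nonvanishing curvature (`IsMinkowskiNorm.hessian_pos`). Hence `K ≤ H²`, with
equality only where `dη_p` is scalar (`exists_shape`, `det_le_half_trace_sq`).

`K` is also the Jacobian of `η` relative to `ω`, so the cone with vertex 0 over `η(A)` has volume at
most `⅓ ∫_A |K| ω` (`IsBirkhoffGaussMap.volume_coneOver_le`). Given a unit vector `v`, maximize
`dN_v` over `M`. At the maximum point `dN_v` kills the tangent plane, and strict convexity forces `η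
= ±v`. Let `P` and `Q` be the sets of points whose own conormal attains its maximum, respectively
minimum, over `M`. Then the cones over `η(P)` and `-η(Q)` cover the open unit ball except 0
(`ball_subset_coneOver`). The two sets are disjoint and `K ≥ 0` on both, so `∫ H² ω ≥ ∫_{P ∪ Q} K ω
≥ 3 vol(B)` (`exists_elliptic`). The same cone computation bounds `λ(∂B)` by `3 vol(B)`, with
equality once `∂B` is known to be a closed surface.

If equality holds, then `H² = K` almost everywhere on `P ∪ Q` and `H = 0` almost everywhere outside,
so `H (K - H²) = 0` on `M` by continuity. Near a point with `H = k ≠ 0` the surface is umbilic, so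
`H` and `η(p) - k p` are locally constant (`eventually_of_umbilic`). The set where they keep their
values is open and closed in `M`. Since `M` need not be connected, the lower bound is proved for
every nonempty open and closed part: a nonempty complement would contribute a second `3 vol(B)`. So
`M` lies in a Minkowski sphere, and it fills that sphere by openness and connectedness
(`IsClosedSurface.eq_sphere`). Conversely, on a sphere of radius `r` one has `H² = r⁻²`, while the
area is at most `3 r² vol(B)`. -/

theorem IsMinkowskiNorm.pos (hN : IsMinkowskiNorm N) {x : E3} (hx : x ≠ 0) : 0 < N x :=
  lt_of_le_of_ne (apply_nonneg N x) fun h => hx (hN.eq_zero x h.symm)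

theorem ne_zero_of_seminorm_eq_one {x : E3} (hx : N x = 1) : x ≠ 0 := by
  rintro rfl
  simp at hx

theorem IsMinkowskiNorm.contDiffAt (hN : IsMinkowskiNorm N) {x : E3} (hx : x ≠ 0) :
    ContDiffAt ℝ ∞ N x :=
  hN.smooth.contDiffAt (isOpen_compl_singleton.mem_nhds hx)

theorem IsMinkowskiNorm.differentiableAt (hN : IsMinkowskiNorm N) {x : E3} (hx : x ≠ 0) :
    DifferentiableAt ℝ N x :=
  (hN.contDiffAt hx).differentiableAt (by simp)

theorem IsMinkowskiNorm.contDiffAt_fderiv (hN : IsMinkowskiNorm N) {x : E3} (hx : x ≠ 0) :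
    ContDiffAt ℝ ∞ (fderiv ℝ N) x :=
  (hN.contDiffAt hx).fderiv_right (by simp)

theorem IsMinkowskiNorm.differentiableAt_fderiv (hN : IsMinkowskiNorm N) {x : E3} (hx : x ≠ 0) :
    DifferentiableAt ℝ (fderiv ℝ N) x :=
  (hN.contDiffAt_fderiv hx).differentiableAt (by simp)

/-- The derivative of a function along a line. -/
theorem hasDerivAt_comp_line {F : Type*} [NormedAddCommGroup F] [NormedSpace ℝ F]
    {E : Type*} [NormedAddCommGroup E] [NormedSpace ℝ E] {f : E → F} {x : E}
    (hf : DifferentiableAt ℝ f x) (w : E) :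
    HasDerivAt (fun t : ℝ => f (x + t • w)) (fderiv ℝ f x w) 0 := by
  have hl : HasDerivAt (fun s : ℝ => x + s • w) w 0 := by
    simpa using ((hasDerivAt_id (0 : ℝ)).smul_const w).const_add x
  exact HasFDerivAt.comp_hasDerivAt (f := fun s : ℝ => x + s • w) (0 : ℝ)
    (by simpa using hf.hasFDerivAt) hl

theorem IsMinkowskiNorm.fderiv_self (hN : IsMinkowskiNorm N) {x : E3} (hx : x ≠ 0) :
    fderiv ℝ N x x = N x := by
  have h1 := hasDerivAt_comp_line (hN.differentiableAt hx) x
  have h2 : HasDerivAt (fun t : ℝ => (1 + t) * N x) (N x) 0 := by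
    simpa using ((hasDerivAt_id (0 : ℝ)).const_add 1).mul_const (N x)
  refine h1.unique (h2.congr_of_eventuallyEq ?_)
  have h0 : ∀ᶠ t : ℝ in 𝓝 0, -1 < t := Ioi_mem_nhds (by norm_num)
  filter_upwards [h0] with t ht
  have : x + t • x = (1 + t) • x := by rw [add_smul, one_smul]
  rw [this, map_smul_eq_mul, Real.norm_eq_abs, abs_of_pos (by linarith)]

/-- By the triangle inequality every forward difference quotient of `N` in the direction `v` is at
most `N v`. Thus `dN_x` has dual norm at most one and supports the unit ball. -/
theorem IsMinkowskiNorm.fderiv_le (hN : IsMinkowskiNorm N) {x : E3} (hx : x ≠ 0) (v : E3) :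
    fderiv ℝ N x v ≤ N v := by
  have h1 := (hasDerivAt_comp_line (hN.differentiableAt hx) v).tendsto_slope_zero_right
  refine le_of_tendsto h1 ?_
  filter_upwards [self_mem_nhdsWithin] with t ht
  have ht : 0 < t := ht
  have h2 : N (x + t • v) ≤ N x + t * N v := by
    refine (map_add_le_add N _ _).trans ?_
    rw [map_smul_eq_mul, Real.norm_eq_abs, abs_of_pos ht]
  simp only [zero_add, zero_smul, add_zero, smul_eq_mul]
  rw [inv_mul_le_iff₀ ht]
  linarith

theorem IsMinkowskiNorm.hessian_symm (hN : IsMinkowskiNorm N) {x : E3} (hx : x ≠ 0) (v w : E3) :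
    fderiv ℝ (fderiv ℝ N) x v w = fderiv ℝ (fderiv ℝ N) x w v :=
  by
  refine (hN.contDiffAt hx).isSymmSndFDerivAt ?_ v w
  simp only [minSmoothness_of_isRCLikeNormedField]
  exact WithTop.coe_le_coe.2 (le_top : (2 : ℕ∞) ≤ ⊤)

theorem IsMinkowskiNorm.hessian_nonneg (hN : IsMinkowskiNorm N) {x : E3} (hx : x ≠ 0) (w : E3) :
    0 ≤ fderiv ℝ (fderiv ℝ N) x w w := by
  have h1 : HasDerivAt (fun t : ℝ => fderiv ℝ N (x + t • w) w)
      (fderiv ℝ (fderiv ℝ N) x w w) 0 :=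
    (hasDerivAt_comp_line (hN.differentiableAt_fderiv hx) w).clm_apply (hasDerivAt_const 0 w)
      |>.congr_deriv (by simp)
  refine ge_of_tendsto h1.tendsto_slope_zero_right ?_
  have hc : ContinuousAt (fun t : ℝ => x + t • w) 0 := by fun_prop
  have h0 : ∀ᶠ t : ℝ in 𝓝[>] 0, x + t • w ≠ 0 :=
    (hc.eventually_ne (by simpa using hx)).filter_mono nhdsWithin_le_nhds
  filter_upwards [self_mem_nhdsWithin, h0] with t ht hne
  have ht : 0 < t := ht
  have ha := hN.fderiv_le hx (x + t • w)
  have hb := hN.fderiv_le hne x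
  have hc := hN.fderiv_self hne
  have hd := hN.fderiv_self hx
  simp only [map_add, map_smul, smul_eq_mul] at ha hc
  simp only [zero_add, zero_smul, add_zero, smul_eq_mul]
  refine mul_nonneg (by positivity) ?_
  -- Monotonicity of the gradient: add the support inequalities at `x` and at `x + t • w` and use
  -- Euler's relation at both points.
  have : 0 ≤ t * (fderiv ℝ N (x + t • w) w - fderiv ℝ N x w) := by linarith
  exact nonneg_of_mul_nonneg_right this ht

theorem IsMinkowskiNorm.hessian_eq_zero (hN : IsMinkowskiNorm N) {x : E3} (hx : x ≠ 0) {w : E3}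
    (h : fderiv ℝ (fderiv ℝ N) x w w = 0) : fderiv ℝ (fderiv ℝ N) x w = 0 := by
  ext v
  have key : ∀ t : ℝ, 0 ≤ 2 * t * fderiv ℝ (fderiv ℝ N) x w v + fderiv ℝ (fderiv ℝ N) x v v := by
    intro t
    have h1 := hN.hessian_nonneg hx (t • w + v)
    simp only [map_add, map_smul, add_apply, smul_apply,
      smul_eq_mul, h, hN.hessian_symm hx v w] at h1
    linarith
  by_contra hne
  have hne : fderiv ℝ (fderiv ℝ N) x w v ≠ 0 := hne
  set b := fderiv ℝ (fderiv ℝ N) x w v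
  set e := fderiv ℝ (fderiv ℝ N) x v v
  -- This value of `t` makes the affine expression in `key` equal to `-1`.
  have h2 := key (-(e + 1) / (2 * b))
  have h3 : 2 * (-(e + 1) / (2 * b)) * b = -(e + 1) := by field_simp
  linarith

/-- The radial retraction `y ↦ y / N y` onto the unit sphere has differential `v ↦ v - dN_x(v) x` at
`x`. It fixes `w` and carries tangent directions of the ambient space to tangent directions of the
sphere. -/
theorem IsMinkowskiNorm.mem_tangentPlane_unitSphere (hN : IsMinkowskiNorm N) {x w : E3}
    (hx : N x = 1) (hw : fderiv ℝ N x w = 0) : w ∈ tangentPlane (unitSphere N) x := by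
  have hx0 := ne_zero_of_seminorm_eq_one hx
  have hd := hN.differentiableAt hx0
  have h1 : HasFDerivAt (fun y => (N y)⁻¹ • y) (ContinuousLinearMap.id ℝ E3 -
      (fderiv ℝ N x).smulRight x) x := by
    have h2 : HasFDerivAt (fun y => (N y)⁻¹) (-(fderiv ℝ N x)) x := by
      have := (hasDerivAt_inv (x := N x) (by simp [hx])).comp_hasFDerivAt x hd.hasFDerivAt
      exact this.congr_fderiv (by ext v; simp [hx])
    refine (h2.smul (hasFDerivAt_id x)).congr_fderiv ?_
    ext v
    simp [hx, sub_eq_add_neg]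
  have h3 := (h1.hasFDerivWithinAt (s := {0}ᶜ)).mapsTo_tangent_cone
  have h4 : tangentConeAt ℝ ({0}ᶜ : Set E3) x = Set.univ :=
    tangentConeAt_of_mem_nhds (isOpen_compl_singleton.mem_nhds hx0)
  have h5 := h3 (x := w) (by rw [h4]; trivial)
  have h6 : (fun y => (N y)⁻¹ • y) '' ({0}ᶜ : Set E3) ⊆ unitSphere N := by
    rintro _ ⟨y, hy, rfl⟩
    have hp := hN.pos hy
    simp only [unitSphere, Set.mem_ofPred_eq, map_smul_eq_mul, norm_inv, Real.norm_eq_abs,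
      abs_of_pos hp]
    exact inv_mul_cancel₀ hp.ne'
  have h7 := tangentConeAt_mono h6 h5
  simp only [hx, inv_one, one_smul, sub_apply, ContinuousLinearMap.id_apply,
    ContinuousLinearMap.smulRight_apply, hw, zero_smul, sub_zero] at h7
  exact Submodule.subset_span h7

/-- On the tangent plane `fderivWithin` is determined by any derivative within `M`. -/
theorem fderivWithin_eq_of_mem_tangentPlane {M : Set E3} {ν : E3 → E3} {p w : E3}
    {ν' : E3 →L[ℝ] E3} (h : HasFDerivWithinAt ν ν' M p) (hw : w ∈ tangentPlane M p) :
    fderivWithin ℝ ν M p w = ν' w := by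
  have h1 := h.differentiableWithinAt.hasFDerivWithinAt.unique_on h
  have hle : tangentPlane M p ≤
      LinearMap.eqLocus (fderivWithin ℝ ν M p : E3 →ₗ[ℝ] E3) (ν' : E3 →ₗ[ℝ] E3) :=
    Submodule.span_le.2 fun y hy => h1 hy
  exact hle hw

theorem normalDifferential_apply_eq_zero {M : Set E3} {ν : E3 → E3} {p : E3}
    {w : tangentPlane M p} (h : fderivWithin ℝ ν M p w = 0) :
    normalDifferential M ν p w = 0 := by
  unfold normalDifferential
  split_ifs with h1
  · exact Subtype.ext h
  · rfl

/-- The curvature hypothesis enters here. A null vector of the semidefinite Hessian lies in its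
kernel, so the differential of the Euclidean normal would kill a nonzero tangent vector and the
Gaussian curvature would vanish. -/
theorem IsMinkowskiNorm.hessian_pos (hN : IsMinkowskiNorm N) {x w : E3}
    (hx : N x = 1) (hw : fderiv ℝ N x w = 0) (hw0 : w ≠ 0) :
    0 < fderiv ℝ (fderiv ℝ N) x w w := by
  have hx0 := ne_zero_of_seminorm_eq_one hx
  refine lt_of_le_of_ne (hN.hessian_nonneg hx0 w) fun h => ?_
  have hz := hN.hessian_eq_zero hx0 h.symm
  have hwT := hN.mem_tangentPlane_unitSphere hx hw
  refine hN.curvature_ne_zero x hx ?_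
  -- The Riesz isomorphism is conjugate-linear in general; over `ℝ` it is repackaged as a linear map
  -- so that the gradient can be differentiated by the chain rule.
  let L : (E3 →L[ℝ] ℝ) →L[ℝ] E3 := LinearMap.toContinuousLinearMap
    { toFun := fun l => (InnerProductSpace.toDual ℝ E3).symm l
      map_add' := fun l l' => map_add _ l l'
      map_smul' := fun c l => by simp }
  have hgrad : HasFDerivAt (gradient N) (L.comp (fderiv ℝ (fderiv ℝ N) x)) x :=
    L.hasFDerivAt.comp x (hN.differentiableAt_fderiv hx0).hasFDerivAt
  have hg0 : gradient N x ≠ 0 := by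
    intro h0
    have h1 : fderiv ℝ N x = 0 := by
      have : (InnerProductSpace.toDual ℝ E3).symm (fderiv ℝ N x) = 0 := h0
      simpa using this
    have h2 := hN.fderiv_self hx0
    simp [h1, hx] at h2
  have hnorm : DifferentiableAt ℝ (fun y : E3 => ‖y‖⁻¹ • y) (gradient N x) :=
    ((differentiableAt_id.norm ℝ hg0).inv (norm_ne_zero_iff.2 hg0)).smul differentiableAt_id
  have hn : HasFDerivAt (euclideanNormal N) _ x := hnorm.hasFDerivAt.comp x hgrad
  have hzero := fderivWithin_eq_of_mem_tangentPlane
    (hn.hasFDerivWithinAt (s := unitSphere N)) hwT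
  simp only [ContinuousLinearMap.comp_apply, hz, map_zero] at hzero
  have hker : normalDifferential (unitSphere N) (euclideanNormal N) x ⟨w, hwT⟩ = 0 :=
    normalDifferential_apply_eq_zero hzero
  by_contra hdet
  have hinj := (LinearMap.equivOfDetNeZero _ hdet).injective
  have := @hinj ⟨w, hwT⟩ 0 (by
    rw [map_zero]
    exact hker)
  exact hw0 (congrArg Subtype.val this)

/-- If `v ≠ w`, their midpoint is interior to the ball by strict convexity, yet it lies on the
supporting plane `dN_v = 1`. Moving it slightly in the direction `v` stays in the ball and crosses
that plane. -/
theorem IsMinkowskiNorm.eq_of_fderiv_eq_one (hN : IsMinkowskiNorm N) {v w : E3}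
    (hv : N v = 1) (hw : N w = 1) (h : fderiv ℝ N v w = 1) : v = w := by
  by_contra hne
  have hv0 := ne_zero_of_seminorm_eq_one hv
  have h1 := hN.strictConvex (x := v) (by simp [hv]) (y := w) (by simp [hw]) hne
    (a := 1 / 2) (b := 1 / 2) (by norm_num) (by norm_num) (by norm_num)
  set m : E3 := (1 / 2 : ℝ) • v + (1 / 2 : ℝ) • w with hm
  have hm1 : fderiv ℝ N v m = 1 := by
    simp [hm, h, hN.fderiv_self hv0, hv]; norm_num
  rw [mem_interior_iff_mem_nhds] at h1
  have hc : ContinuousAt (fun t : ℝ => m + t • v) 0 := by fun_prop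
  have h2 : ∀ᶠ t : ℝ in 𝓝[>] 0, N (m + t • v) ≤ 1 :=
    (hc.eventually (p := fun y => N y ≤ 1) (by simp only [zero_smul, add_zero]; exact h1)).filter_mono nhdsWithin_le_nhds
  obtain ⟨t, ht, ht0⟩ := (h2.and self_mem_nhdsWithin).exists
  have ht0 : 0 < t := ht0
  have h3 := hN.fderiv_le hv0 (m + t • v)
  simp only [map_add, map_smul, smul_eq_mul, hm1, hN.fderiv_self hv0, hv] at h3
  linarith

theorem continuous_seminorm (N : Seminorm ℝ E3) : Continuous N := by
  have h := N.convexOn.continuousOn_interior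
  rw [interior_univ] at h
  exact continuousOn_univ.1 h

theorem IsMinkowskiNorm.exists_mul_norm_le (hN : IsMinkowskiNorm N) :
    ∃ c : ℝ, 0 < c ∧ ∀ x, c * ‖x‖ ≤ N x := by
  obtain ⟨z, hz, hmin⟩ := (isCompact_sphere (0 : E3) 1).exists_isMinOn
    (NormedSpace.sphere_nonempty.2 zero_le_one) (continuous_seminorm N).continuousOn
  have hz0 : z ≠ 0 := by
    rintro rfl
    simp at hz
  refine ⟨N z, hN.pos hz0, fun x => ?_⟩
  rcases eq_or_ne x 0 with rfl | hx
  · simp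
  have hx' : 0 < ‖x‖ := norm_pos_iff.2 hx
  have h1 : N z ≤ N (‖x‖⁻¹ • x) := hmin (by simp [norm_smul, hx'.ne'])
  rw [map_smul_eq_mul, norm_inv, norm_norm] at h1
  rwa [le_inv_mul_iff₀ hx', mul_comm] at h1

theorem IsMinkowskiNorm.isBounded (hN : IsMinkowskiNorm N) (r : ℝ) :
    Bornology.IsBounded {x | N x ≤ r} := by
  obtain ⟨c, hc, h⟩ := hN.exists_mul_norm_le
  refine (Metric.isBounded_closedBall (x := (0 : E3)) (r := r / c)).subset fun x hx => ?_
  have hx : N x ≤ r := hx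
  rw [mem_closedBall_zero_iff, le_div_iff₀ hc, mul_comm]
  exact (h x).trans hx

/-- The volume of the unit ball of `N`. -/
def ballVolume (N : Seminorm ℝ E3) : ℝ≥0∞ := volume {x | N x < 1}

theorem IsMinkowskiNorm.ballVolume_lt_top (hN : IsMinkowskiNorm N) : ballVolume N < ⊤ :=
  (measure_mono (t := {x | N x ≤ 1}) fun _ hx => le_of_lt (α := ℝ) hx).trans_lt (hN.isBounded 1).measure_lt_top

theorem ballVolume_pos (N : Seminorm ℝ E3) : 0 < ballVolume N :=
  (isOpen_lt (continuous_seminorm N) continuous_const).measure_pos volume ⟨0, by simp⟩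

end Norm

/-! ### The determinant -/

theorem det3_eq (X Y Z : E3) : det3 X Y Z = X 0 * Y 1 * Z 2 - X 0 * Y 2 * Z 1 - X 1 * Y 0 * Z 2
    + X 1 * Y 2 * Z 0 + X 2 * Y 0 * Z 1 - X 2 * Y 1 * Z 0 := by
  rw [det3, Matrix.det_fin_three]
  simp

/-- Cramer's rule without division. -/
theorem det3_smul_eq (X Y Z W : E3) :
    det3 X Y Z • W = det3 W Y Z • X + det3 X W Z • Y + det3 X Y W • Z := by
  ext i
  fin_cases i <;> simp [det3_eq] <;> ring

theorem exists_coeffs_of_det3_ne_zero {X Y Z : E3} (h : det3 X Y Z ≠ 0) (W : E3) :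
    ∃ a b c : ℝ, W = a • X + b • Y + c • Z := by
  refine ⟨det3 W Y Z / det3 X Y Z, det3 X W Z / det3 X Y Z, det3 X Y W / det3 X Y Z, ?_⟩
  have := congrArg (fun V => (det3 X Y Z)⁻¹ • V) (det3_smul_eq X Y Z W)
  simp only [smul_smul, smul_add, inv_mul_cancel₀ h, one_smul] at this
  simpa only [div_eq_inv_mul] using this

theorem det3_comb (X Y Z : E3) (a b c d : ℝ) :
    det3 (a • X + c • Y) (b • X + d • Y) Z = (a * d - b * c) * det3 X Y Z := by
  simp [det3_eq]
  ring

theorem det3_smul_left (X Y Z : E3) (t : ℝ) : det3 X Y (t • Z) = t * det3 X Y Z := by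
  simp [det3_eq]
  ring

theorem det3_ne_zero {X Y Z : E3} (hXY : ∀ a b : ℝ, a • X + b • Y = 0 → a = 0 ∧ b = 0)
    {l : E3 →L[ℝ] ℝ} (hX : l X = 0) (hY : l Y = 0) (hZ : l Z ≠ 0) : det3 X Y Z ≠ 0 := by
  intro h
  obtain ⟨v, hv0, hv⟩ := Matrix.exists_vecMul_eq_zero_iff.2 h
  have hrel : v 0 • X + v 1 • Y + v 2 • Z = 0 := by
    ext i
    have := congrFun hv i
    simpa [Matrix.vecMul, dotProduct, Fin.sum_univ_three] using this
  have h2 : v 2 = 0 := by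
    have := congrArg l hrel
    simpa [hX, hY, hZ] using this
  have h01 := hXY (v 0) (v 1) (by simpa [h2] using hrel)
  refine hv0 (funext fun i => ?_)
  fin_cases i
  · exact h01.1
  · exact h01.2
  · exact h2

/-! ### Local parametrizations -/

/-- The map into `ℝ³` underlying a local parametrization. -/
abbrev embed {M : Set E3} (φ : OpenPartialHomeomorph (ℝ × ℝ) M) : ℝ × ℝ → E3 := fun x => (φ x : E3)

theorem apply_eq_comb {F : Type*} [NormedAddCommGroup F] [NormedSpace ℝ F] (L : ℝ × ℝ →L[ℝ] F)
    (w : ℝ × ℝ) : L w = w.1 • L (1, 0) + w.2 • L (0, 1) := by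
  rw [← map_smul, ← map_smul, ← map_add]
  simp

section Chart

variable {M : Set E3} {φ : OpenPartialHomeomorph (ℝ × ℝ) M} {x : ℝ × ℝ}

/-- This translates limits and germs along `M` into statements in the parameter plane. -/
theorem map_embed_nhds (hx : x ∈ φ.source) : map (embed φ) (𝓝 x) = 𝓝[M] (embed φ x) := by
  rw [← map_nhds_subtype_val, ← φ.map_nhds_eq hx, Filter.map_map]
  rfl

theorem embed_injOn : Set.InjOn (embed φ) φ.source := fun _ hx _ hy h =>
  φ.injOn hx hy (Subtype.ext h)

theorem IsLocalParam.contDiffAt (hφ : IsLocalParam φ) (hx : x ∈ φ.source) :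
    ContDiffAt ℝ ∞ (embed φ) x :=
  hφ.smooth.contDiffAt (φ.open_source.mem_nhds hx)

theorem IsLocalParam.differentiableAt (hφ : IsLocalParam φ) (hx : x ∈ φ.source) :
    DifferentiableAt ℝ (embed φ) x :=
  (hφ.contDiffAt hx).differentiableAt (by simp)

theorem IsLocalParam.linearIndependent (hφ : IsLocalParam φ) (hx : x ∈ φ.source) (a b : ℝ)
    (h : a • fderiv ℝ (embed φ) x (1, 0) + b • fderiv ℝ (embed φ) x (0, 1) = 0) :
    a = 0 ∧ b = 0 := by
  have h1 : fderiv ℝ (embed φ) x (a, b) = fderiv ℝ (embed φ) x 0 := by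
    rw [apply_eq_comb _ (a, b), map_zero]
    exact h
  simpa using hφ.regular x hx h1

/-- A local parametrization has a smooth local left inverse defined on `ℝ³`. -/
theorem IsLocalParam.exists_retraction (hφ : IsLocalParam φ) (hx : x ∈ φ.source) :
    ∃ G : E3 → ℝ × ℝ, ContDiffAt ℝ ∞ G (embed φ x) ∧ ∀ᶠ y in 𝓝 x, G (embed φ y) = y := by
  -- Composing the parametrization with a linear left inverse of its differential gives a planar map
  -- with identity derivative at `x`. The inverse function theorem then applies.
  obtain ⟨π, hπ⟩ := LinearMap.exists_leftInverse_of_injective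
    (fderiv ℝ (embed φ) x : ℝ × ℝ →ₗ[ℝ] E3) (LinearMap.ker_eq_bot.2 (hφ.regular x hx))
  set P : E3 →L[ℝ] ℝ × ℝ := π.toContinuousLinearMap
  have h1 : ContDiffAt ℝ ∞ (fun y => P (embed φ y)) x :=
    P.contDiff.contDiffAt.comp x (hφ.contDiffAt hx)
  have h2 : HasFDerivAt (fun y => P (embed φ y))
      ((ContinuousLinearEquiv.refl ℝ (ℝ × ℝ) : (ℝ × ℝ) ≃L[ℝ] (ℝ × ℝ)) : (ℝ × ℝ) →L[ℝ] (ℝ × ℝ)) x := by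
    refine (P.hasFDerivAt.comp x (hφ.differentiableAt hx).hasFDerivAt).congr_fderiv ?_
    refine ContinuousLinearMap.ext fun w => ?_
    exact LinearMap.congr_fun hπ w
  refine ⟨fun q => h1.localInverse h2 (by simp) (P q), ?_, ?_⟩
  · exact (h1.to_localInverse h2 (by simp)).comp (embed φ x) P.contDiff.contDiffAt
  · exact (h1.hasStrictFDerivAt' h2 (by simp)).eventually_left_inverse

/-- With the smooth retraction `G`, the function `ν ∘ embed φ ∘ G` is defined near the point in
`ℝ³`, is differentiable there and agrees with `ν` on `M`. -/
theorem IsLocalParam.differentiableWithinAt {F : Type*} [NormedAddCommGroup F] [NormedSpace ℝ F]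
    (hφ : IsLocalParam φ) (hx : x ∈ φ.source) {ν : E3 → F}
    (hν : DifferentiableAt ℝ (fun y => ν (embed φ y)) x) :
    DifferentiableWithinAt ℝ ν M (embed φ x) := by
  obtain ⟨G, hG, hGφ⟩ := hφ.exists_retraction hx
  have h0 : G (embed φ x) = x := hGφ.self_of_nhds
  have hev : ∀ᶠ q in 𝓝[M] (embed φ x), ν q = ν (embed φ (G q)) := by
    rw [← map_embed_nhds hx, eventually_map]
    filter_upwards [hGφ] with y hy
    rw [hy]
  have h2 : DifferentiableAt ℝ (fun q => ν (embed φ (G q))) (embed φ x) :=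
    DifferentiableAt.comp (f := G) (g := fun y => ν (embed φ y)) _ (by rwa [h0])
      (hG.differentiableAt (by simp))
  exact h2.differentiableWithinAt.congr_of_eventuallyEq hev (by simp [h0])

theorem IsLocalParam.fderiv_comp {F : Type*} [NormedAddCommGroup F] [NormedSpace ℝ F]
    (hφ : IsLocalParam φ) (hx : x ∈ φ.source) {ν : E3 → F}
    (hν : DifferentiableAt ℝ (fun y => ν (embed φ y)) x) (w : ℝ × ℝ) :
    fderivWithin ℝ ν M (embed φ x) (fderiv ℝ (embed φ) x w)
      = fderiv ℝ (fun y => ν (embed φ y)) x w := by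
  have h1 := (hφ.differentiableWithinAt hx hν).hasFDerivWithinAt
  have h2 := h1.comp_hasFDerivAt x (hφ.differentiableAt hx).hasFDerivAt
    (Eventually.of_forall fun y => (φ y).2)
  exact (congrArg (fun L => L w) h2.fderiv).symm

theorem IsLocalParam.mem_tangentPlane (hφ : IsLocalParam φ) (hx : x ∈ φ.source) (w : ℝ × ℝ) :
    fderiv ℝ (embed φ) x w ∈ tangentPlane M (embed φ x) := by
  have h1 := ((hφ.differentiableAt hx).hasFDerivAt.hasFDerivWithinAt
    (s := φ.source)).mapsTo_tangent_cone
  have h2 : tangentConeAt ℝ φ.source x = Set.univ :=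
    tangentConeAt_of_mem_nhds (φ.open_source.mem_nhds hx)
  have h3 := h1 (x := w) (by rw [h2]; trivial)
  refine Submodule.subset_span (tangentConeAt_mono ?_ h3)
  rintro _ ⟨y, -, rfl⟩
  exact (φ y).2

/-- On `M` the map `embed φ ∘ G` is the identity near the point, so its derivative fixes every
tangent direction. That derivative factors through the differential of the parametrization. -/
theorem IsLocalParam.tangentPlane_eq (hφ : IsLocalParam φ) (hx : x ∈ φ.source) :
    tangentPlane M (embed φ x) = LinearMap.range (fderiv ℝ (embed φ) x : ℝ × ℝ →ₗ[ℝ] E3) := by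
  refine le_antisymm (Submodule.span_le.2 fun v hv => ?_) ?_
  · obtain ⟨G, hG, hGφ⟩ := hφ.exists_retraction hx
    have h0 : G (embed φ x) = x := hGφ.self_of_nhds
    have h1 : HasFDerivWithinAt (fun q => embed φ (G q)) _ M (embed φ x) :=
      (HasFDerivAt.comp (f := G) (g := embed φ) (embed φ x)
        (by rw [h0]; exact (hφ.differentiableAt hx).hasFDerivAt)
        (hG.differentiableAt (by simp)).hasFDerivAt).hasFDerivWithinAt
    have h2 : HasFDerivWithinAt (fun q => embed φ (G q)) (ContinuousLinearMap.id ℝ E3) M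
        (embed φ x) := by
      refine (hasFDerivWithinAt_id _ _).congr_of_eventuallyEq ?_ (by simp [h0])
      change ∀ᶠ q in 𝓝[M] (embed φ x), embed φ (G q) = q
      rw [← map_embed_nhds hx, eventually_map]
      filter_upwards [hGφ] with y hy
      rw [hy]
    have h3 := h1.unique_on h2 hv
    exact ⟨_, h3⟩
  · rintro _ ⟨w, rfl⟩
    exact hφ.mem_tangentPlane hx w

/-- The basis of the tangent plane given by the partial derivatives. -/
def IsLocalParam.tangentBasis (hφ : IsLocalParam φ) (hx : x ∈ φ.source) :
    Module.Basis (Fin 2) ℝ (tangentPlane M (embed φ x)) :=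
  (((Pi.basisFun ℝ (Fin 2)).map (LinearEquiv.finTwoArrow ℝ ℝ)).map
    (LinearEquiv.ofInjective (fderiv ℝ (embed φ) x : ℝ × ℝ →ₗ[ℝ] E3) (hφ.regular x hx))).map
    (LinearEquiv.ofEq _ _ (hφ.tangentPlane_eq hx).symm)

theorem IsLocalParam.tangentBasis_zero (hφ : IsLocalParam φ) (hx : x ∈ φ.source) :
    (hφ.tangentBasis hx 0 : E3) = fderiv ℝ (embed φ) x (1, 0) := by
  simp [tangentBasis, LinearEquiv.finTwoArrow]

theorem IsLocalParam.tangentBasis_one (hφ : IsLocalParam φ) (hx : x ∈ φ.source) :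
    (hφ.tangentBasis hx 1 : E3) = fderiv ℝ (embed φ) x (0, 1) := by
  simp [tangentBasis, LinearEquiv.finTwoArrow]

/-- The matrix of the differential of a normal map in a local parametrization. -/
theorem IsLocalParam.normalDifferential_basis (hφ : IsLocalParam φ) (hx : x ∈ φ.source)
    {ν : E3 → E3} (hν : DifferentiableAt ℝ (fun y => ν (embed φ y)) x) {a b c d : ℝ}
    (hu : fderiv ℝ (fun y => ν (embed φ y)) x (1, 0)
      = a • fderiv ℝ (embed φ) x (1, 0) + c • fderiv ℝ (embed φ) x (0, 1))
    (hv : fderiv ℝ (fun y => ν (embed φ y)) x (0, 1)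
      = b • fderiv ℝ (embed φ) x (1, 0) + d • fderiv ℝ (embed φ) x (0, 1)) :
    LinearMap.toMatrix (hφ.tangentBasis hx) (hφ.tangentBasis hx)
      (normalDifferential M ν (embed φ x)) = !![a, b; c, d] := by
  set B := hφ.tangentBasis hx
  have hB0 : (B 0 : E3) = _ := hφ.tangentBasis_zero hx
  have hB1 : (B 1 : E3) = _ := hφ.tangentBasis_one hx
  have hmaps : ∀ v ∈ tangentPlane M (embed φ x),
      (fderivWithin ℝ ν M (embed φ x) : E3 →ₗ[ℝ] E3) v ∈ tangentPlane M (embed φ x) := by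
    intro v hv'
    rw [hφ.tangentPlane_eq hx] at hv'
    obtain ⟨w, rfl⟩ := hv'
    have := hφ.fderiv_comp hx hν w
    simp only [ContinuousLinearMap.coe_coe]
    rw [this, apply_eq_comb, hu, hv]
    have h0 := hφ.mem_tangentPlane hx (1, 0)
    have h1 := hφ.mem_tangentPlane hx (0, 1)
    exact Submodule.add_mem _
      (Submodule.smul_mem _ _ (Submodule.add_mem _ (Submodule.smul_mem _ _ h0)
        (Submodule.smul_mem _ _ h1)))
      (Submodule.smul_mem _ _ (Submodule.add_mem _ (Submodule.smul_mem _ _ h0)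
        (Submodule.smul_mem _ _ h1)))
  have hS : normalDifferential M ν (embed φ x)
      = (fderivWithin ℝ ν M (embed φ x) : E3 →ₗ[ℝ] E3).restrict hmaps := dif_pos hmaps
  have hS0 : normalDifferential M ν (embed φ x) (B 0) = a • B 0 + c • B 1 := by
    rw [hS]
    refine Subtype.ext ?_
    simp only [LinearMap.coe_restrict_apply, ContinuousLinearMap.coe_coe, Submodule.coe_add,
      Submodule.coe_smul, hB0, hB1]
    rw [hφ.fderiv_comp hx hν, hu]
  have hS1 : normalDifferential M ν (embed φ x) (B 1) = b • B 0 + d • B 1 := by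
    rw [hS]
    refine Subtype.ext ?_
    simp only [LinearMap.coe_restrict_apply, ContinuousLinearMap.coe_coe, Submodule.coe_add,
      Submodule.coe_smul, hB0, hB1]
    rw [hφ.fderiv_comp hx hν, hv]
  ext i j
  rw [LinearMap.toMatrix_apply]
  fin_cases j
  · simp only [Fin.zero_eta, Fin.isValue, hS0]
    fin_cases i <;> simp
  · simp only [Fin.mk_one, Fin.isValue, hS1]
    fin_cases i <;> simp

/-- The mean curvature in terms of a local parametrization. -/
theorem IsLocalParam.meanCurvature_eq (hφ : IsLocalParam φ) (hx : x ∈ φ.source) {ν : E3 → E3}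
    (hν : DifferentiableAt ℝ (fun y => ν (embed φ y)) x) {a b c d : ℝ}
    (hu : fderiv ℝ (fun y => ν (embed φ y)) x (1, 0)
      = a • fderiv ℝ (embed φ) x (1, 0) + c • fderiv ℝ (embed φ) x (0, 1))
    (hv : fderiv ℝ (fun y => ν (embed φ y)) x (0, 1)
      = b • fderiv ℝ (embed φ) x (1, 0) + d • fderiv ℝ (embed φ) x (0, 1)) :
    meanCurvature M ν (embed φ x) = (a + d) / 2 := by
  rw [meanCurvature, LinearMap.trace_eq_matrix_trace ℝ (hφ.tangentBasis hx),
    hφ.normalDifferential_basis hx hν hu hv, Matrix.trace_fin_two_of]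
  ring

/-- The Gaussian curvature in terms of a local parametrization. -/
theorem IsLocalParam.gaussianCurvature_eq (hφ : IsLocalParam φ) (hx : x ∈ φ.source)
    {ν : E3 → E3} (hν : DifferentiableAt ℝ (fun y => ν (embed φ y)) x) {a b c d : ℝ}
    (hu : fderiv ℝ (fun y => ν (embed φ y)) x (1, 0)
      = a • fderiv ℝ (embed φ) x (1, 0) + c • fderiv ℝ (embed φ) x (0, 1))
    (hv : fderiv ℝ (fun y => ν (embed φ y)) x (0, 1)
      = b • fderiv ℝ (embed φ) x (1, 0) + d • fderiv ℝ (embed φ) x (0, 1)) :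
    gaussianCurvature M ν (embed φ x) = a * d - b * c := by
  rw [gaussianCurvature, ← LinearMap.det_toMatrix (hφ.tangentBasis hx),
    hφ.normalDifferential_basis hx hν hu hv, Matrix.det_fin_two_of]

end Chart

/-! ### The Birkhoff–Gauss map: smoothness, self-adjointness and curvatures -/

section GaussMap

variable {N : Seminorm ℝ E3} {M : Set E3} {η : E3 → E3}
  {φ : OpenPartialHomeomorph (ℝ × ℝ) M} {x : ℝ × ℝ}

theorem IsBirkhoffGaussMap.ne_zero (hη : IsBirkhoffGaussMap N M η) {p : E3} (hp : p ∈ M) :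
    η p ≠ 0 :=
  ne_zero_of_seminorm_eq_one (hη.norm_eq_one p hp)

theorem IsBirkhoffGaussMap.fderiv_self (hη : IsBirkhoffGaussMap N M η) (hN : IsMinkowskiNorm N)
    {p : E3} (hp : p ∈ M) : fderiv ℝ N (η p) (η p) = 1 := by
  rw [hN.fderiv_self (hη.ne_zero hp), hη.norm_eq_one p hp]

/-- Birkhoff orthogonality says that `t ↦ N (η p + t • w)` has a minimum at 0. So `fderiv ℝ N (η p)`
is the conormal of `M` at `p`, normalized by `η p`. -/
theorem IsBirkhoffGaussMap.fderiv_eq_zero (hη : IsBirkhoffGaussMap N M η)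
    (hN : IsMinkowskiNorm N) {p w : E3} (hp : p ∈ M) (hw : w ∈ tangentPlane M p) :
    fderiv ℝ N (η p) w = 0 := by
  have h1 := hasDerivAt_comp_line (hN.differentiableAt (hη.ne_zero hp)) w
  refine IsLocalMin.hasDerivAt_eq_zero (Eventually.of_forall fun t => ?_) h1
  simpa using hη.orthogonal p hp w hw t

theorem IsBirkhoffGaussMap.fderiv_embed (hη : IsBirkhoffGaussMap N M η) (hN : IsMinkowskiNorm N)
    (hφ : IsLocalParam φ) (hx : x ∈ φ.source) (w : ℝ × ℝ) :
    fderiv ℝ N (η (embed φ x)) (fderiv ℝ (embed φ) x w) = 0 :=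
  hη.fderiv_eq_zero hN (φ x).2 (hφ.mem_tangentPlane hx w)

theorem IsBirkhoffGaussMap.det3_ne_zero (hη : IsBirkhoffGaussMap N M η) (hN : IsMinkowskiNorm N)
    (hφ : IsLocalParam φ) (hx : x ∈ φ.source) :
    det3 (fderiv ℝ (embed φ) x (1, 0)) (fderiv ℝ (embed φ) x (0, 1)) (η (embed φ x)) ≠ 0 :=
  MinkowskiGeometry.det3_ne_zero (hφ.linearIndependent hx) (hη.fderiv_embed hN hφ hx _)
    (hη.fderiv_embed hN hφ hx _) (by rw [hη.fderiv_self hN (φ x).2]; exact one_ne_zero)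

theorem IsBirkhoffGaussMap.exists_comb (hη : IsBirkhoffGaussMap N M η) (hN : IsMinkowskiNorm N)
    (hφ : IsLocalParam φ) (hx : x ∈ φ.source) {w : E3}
    (hw : fderiv ℝ N (η (embed φ x)) w = 0) :
    ∃ a b : ℝ, w = a • fderiv ℝ (embed φ) x (1, 0) + b • fderiv ℝ (embed φ) x (0, 1) := by
  obtain ⟨a, b, c, h⟩ := exists_coeffs_of_det3_ne_zero (hη.det3_ne_zero hN hφ hx) w
  have hc : c = 0 := by
    have := congrArg (fderiv ℝ N (η (embed φ x))) h
    rw [hw] at this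
    simpa [hη.fderiv_embed hN hφ hx, hη.fderiv_self hN (φ x).2] using this.symm
  exact ⟨a, b, by simpa [hc] using h⟩

theorem IsBirkhoffGaussMap.continuousAt (hη : IsBirkhoffGaussMap N M η) (hx : x ∈ φ.source) :
    ContinuousAt (fun y => η (embed φ y)) x := by
  have h1 : Tendsto (embed φ) (𝓝 x) (𝓝[M] (embed φ x)) := (map_embed_nhds hx).le
  exact (hη.continuousOn (embed φ x) (φ x).2).tendsto.comp h1

/-- A Birkhoff-Gauss map is smooth. -/
theorem IsBirkhoffGaussMap.contDiffAt (hη : IsBirkhoffGaussMap N M η) (hN : IsMinkowskiNorm N)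
    (hφ : IsLocalParam φ) (hx : x ∈ φ.source) :
    ContDiffAt ℝ ∞ (fun y => η (embed φ y)) x := by
  set p := embed φ x
  have hp : p ∈ M := (φ x).2
  have hp0 := hη.ne_zero hp
  -- `v = η (embed φ y)` solves `Ψ (y, v) = (1, 0, 0)`: it has unit norm and its conormal kills both
  -- partial derivatives. The implicit function theorem then yields smoothness.
  set Ψ : (ℝ × ℝ) × E3 → ℝ × ℝ × ℝ := fun z => (N z.2,
    fderiv ℝ N z.2 (fderiv ℝ (embed φ) z.1 (1, 0)),
    fderiv ℝ N z.2 (fderiv ℝ (embed φ) z.1 (0, 1))) with hΨ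
  have hg' : ContDiffAt ℝ ∞ (fun z : (ℝ × ℝ) × E3 => fderiv ℝ (embed φ) z.1) (x, η p) :=
    ContDiffAt.comp (g := fderiv ℝ (embed φ)) (f := Prod.fst) (x, η p)
      ((hφ.contDiffAt hx).fderiv_right (by simp)) contDiffAt_fst
  have hN' : ContDiffAt ℝ ∞ (fun z : (ℝ × ℝ) × E3 => fderiv ℝ N z.2) (x, η p) :=
    ContDiffAt.comp (g := fderiv ℝ N) (f := Prod.snd) (x, η p)
      (hN.contDiffAt_fderiv hp0) contDiffAt_snd
  have hN0 : ContDiffAt ℝ ∞ (fun z : (ℝ × ℝ) × E3 => N z.2) (x, η p) :=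
    ContDiffAt.comp (g := N) (f := Prod.snd) (x, η p) (hN.contDiffAt hp0) contDiffAt_snd
  have hc : ContDiffAt ℝ ∞ Ψ (x, η p) :=
    hN0.prodMk ((hN'.clm_apply (hg'.clm_apply contDiffAt_const)).prodMk
      (hN'.clm_apply (hg'.clm_apply contDiffAt_const)))
  have hinv : (fderiv ℝ Ψ (x, η p) ∘L .inr ℝ (ℝ × ℝ) E3).IsInvertible := by
    set L := fderiv ℝ Ψ (x, η p) ∘L .inr ℝ (ℝ × ℝ) E3
    have h1 : HasFDerivAt (fun v => Ψ (x, v)) L (η p) :=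
      ((hc.differentiableAt (by simp)).hasFDerivAt).comp (η p) (hasFDerivAt_prodMk_right x (η p))
    have hc1 : ∀ X : E3, HasFDerivAt (fun v => fderiv ℝ N v X)
        ((fderiv ℝ (fderiv ℝ N) (η p)).flip X) (η p) := fun X => by
      refine ((hN.differentiableAt_fderiv hp0).hasFDerivAt.clm_apply
        (hasFDerivAt_const X _)).congr_fderiv ?_
      ext v
      simp
    have h2 : HasFDerivAt (fun v => Ψ (x, v)) _ (η p) :=
      (hN.differentiableAt hp0).hasFDerivAt.prodMk
      ((hc1 (fderiv ℝ (embed φ) x (1, 0))).prodMk (hc1 (fderiv ℝ (embed φ) x (0, 1))))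
    have hL := h1.unique h2
    -- A vector in the kernel is tangent and Hessian-orthogonal to the tangent plane, hence null for
    -- a positive definite form.
    have hinj : Function.Injective (L : E3 →ₗ[ℝ] ℝ × ℝ × ℝ) := by
      refine (injective_iff_map_eq_zero _).2 fun w hw => ?_
      have hw' : L w = 0 := hw
      simp only [hL, ContinuousLinearMap.prod_apply, ContinuousLinearMap.flip_apply,
        Prod.mk_eq_zero] at hw'
      obtain ⟨hw0, hwX, hwY⟩ := hw'
      by_contra hne
      obtain ⟨a, b, hab⟩ := hη.exists_comb hN hφ hx hw0
      have hpos := hN.hessian_pos (hη.norm_eq_one p hp) hw0 hne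
      have : fderiv ℝ (fderiv ℝ N) (η p) w w = 0 := by
        have := congrArg (fderiv ℝ (fderiv ℝ N) (η p) w) hab
        rwa [map_add, map_smul, map_smul, hwX, hwY, smul_zero, smul_zero, add_zero] at this
      exact hpos.ne' this
    refine ⟨(LinearEquiv.ofInjectiveOfFinrankEq (L : E3 →ₗ[ℝ] ℝ × ℝ × ℝ) hinj
      (by simp)).toContinuousLinearEquiv, ?_⟩
    ext v <;> rfl
  have h1 := hc.eventually_apply_eq_iff_implicitFunction (by simp) hinv
  have h2 := hc.contDiffAt_implicitFunction (by simp) hinv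
  refine h2.congr_of_eventuallyEq ?_
  -- Continuity of `η` keeps it in the neighbourhood where the implicit solution is unique; it
  -- excludes a jump to `-η`.
  have h3 : Tendsto (fun y => (y, η (embed φ y))) (𝓝 x) (𝓝 (x, η p)) :=
    continuousAt_id.prodMk (hη.continuousAt hx)
  have hval : ∀ y ∈ φ.source, Ψ (y, η (embed φ y)) = (1, 0, 0) := fun y hy => by
    simp only [hΨ, hη.norm_eq_one _ (φ y).2, hη.fderiv_embed hN hφ hy]
  filter_upwards [h3.eventually h1, φ.open_source.mem_nhds hx] with y hy hys
  exact (hy.1 ((hval y hys).trans (hval x hx).symm)).symm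

theorem IsBirkhoffGaussMap.differentiableAt (hη : IsBirkhoffGaussMap N M η)
    (hN : IsMinkowskiNorm N) (hφ : IsLocalParam φ) (hx : x ∈ φ.source) :
    DifferentiableAt ℝ (fun y => η (embed φ y)) x :=
  (hη.contDiffAt hN hφ hx).differentiableAt (by simp)

/-- Differentiating `N ∘ η = 1` shows that `dη` takes values in the kernel of the conormal, that is,
in the tangent plane. -/
theorem IsBirkhoffGaussMap.fderiv_fderiv_comp (hη : IsBirkhoffGaussMap N M η)
    (hN : IsMinkowskiNorm N) (hφ : IsLocalParam φ) (hx : x ∈ φ.source) (w : ℝ × ℝ) :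
    fderiv ℝ N (η (embed φ x)) (fderiv ℝ (fun y => η (embed φ y)) x w) = 0 := by
  have h1 := (hN.differentiableAt (hη.ne_zero (φ x).2)).hasFDerivAt.comp x
    (hη.differentiableAt hN hφ hx).hasFDerivAt
  have h2 : HasFDerivAt (fun y => N (η (embed φ y))) (0 : ℝ × ℝ →L[ℝ] ℝ) x :=
    (hasFDerivAt_const (1 : ℝ) x).congr_of_eventuallyEq
      (Eventually.of_forall fun y => hη.norm_eq_one _ (φ y).2)
  exact congrArg (fun L => L w) (h1.unique h2)

/-- The second fundamental form, as the Hessian of the norm and as the conormal component of the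
second derivatives of a parametrization. -/
theorem IsBirkhoffGaussMap.hessian_eq (hη : IsBirkhoffGaussMap N M η)
    (hN : IsMinkowskiNorm N) (hφ : IsLocalParam φ) (hx : x ∈ φ.source) (w w' : ℝ × ℝ) :
    fderiv ℝ (fderiv ℝ N) (η (embed φ x)) (fderiv ℝ (fun y => η (embed φ y)) x w)
        (fderiv ℝ (embed φ) x w')
      = -fderiv ℝ N (η (embed φ x)) (fderiv ℝ (fderiv ℝ (embed φ)) x w w') := by
  have h1 : HasFDerivAt (fun y => fderiv ℝ N (η (embed φ y))) _ x :=
    (hN.differentiableAt_fderiv (hη.ne_zero (φ x).2)).hasFDerivAt.comp x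
    (hη.differentiableAt hN hφ hx).hasFDerivAt
  have h2 : DifferentiableAt ℝ (fderiv ℝ (embed φ)) x :=
    ((hφ.contDiffAt hx).fderiv_right (m := ∞) (by simp)).differentiableAt (by simp)
  have h3 := h1.clm_apply (h2.hasFDerivAt.clm_apply (hasFDerivAt_const w' x))
  have h4 : HasFDerivAt (fun y => fderiv ℝ N (η (embed φ y)) (fderiv ℝ (embed φ) y w'))
      (0 : ℝ × ℝ →L[ℝ] ℝ) x := by
    refine (hasFDerivAt_const (0 : ℝ) x).congr_of_eventuallyEq ?_
    filter_upwards [φ.open_source.mem_nhds hx] with y hy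
    exact hη.fderiv_embed hN hφ hy w'
  have h5 := congrArg (fun L => L w) (h3.unique h4)
  simp at h5
  linarith

/-- The algebra of a self-adjoint endomorphism of a Euclidean plane: `det ≤ (tr / 2)²`. -/
theorem det_le_half_trace_sq {a b c d E F G : ℝ} (hE : 0 < E) (hD : 0 < E * G - F ^ 2)
    (h : a * F + c * G = b * E + d * F) :
    a * d - b * c ≤ ((a + d) / 2) ^ 2 ∧
      (a * d - b * c = ((a + d) / 2) ^ 2 → a = d ∧ b = 0 ∧ c = 0) := by
  -- `(a - d)² + 4bc` is the discriminant of the characteristic polynomial. After multiplication by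
  -- `E²`, the self-adjointness relation turns it into a sum of two nonnegative terms, which vanish
  -- together only for a scalar matrix.
  have key : E ^ 2 * ((a - d) ^ 2 + 4 * (b * c))
      = (E * (a - d) + 2 * c * F) ^ 2 + 4 * c ^ 2 * (E * G - F ^ 2) := by
    have hb : b * E = (a - d) * F + c * G := by linarith
    have : E ^ 2 * ((a - d) ^ 2 + 4 * (b * c))
      = E ^ 2 * (a - d) ^ 2 + 4 * E * c * (b * E) := by ring
    rw [this, hb]
    ring
  have hE2 : 0 < E ^ 2 := by positivity
  have hc2 : 0 ≤ 4 * c ^ 2 * (E * G - F ^ 2) := by positivity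
  constructor
  · have : 0 ≤ (a - d) ^ 2 + 4 * (b * c) :=
      nonneg_of_mul_nonneg_right (by rw [key]; positivity) hE2
    nlinarith
  · intro heq
    have h0 : (a - d) ^ 2 + 4 * (b * c) = 0 := by nlinarith
    rw [h0, mul_zero] at key
    have hz1 : (E * (a - d) + 2 * c * F) ^ 2 = 0 :=
      le_antisymm (by linarith) (sq_nonneg _)
    have hz2 : 4 * c ^ 2 * (E * G - F ^ 2) = 0 := by linarith
    have hc : c = 0 := by
      rcases mul_eq_zero.1 hz2 with hh | hh
      · simpa using hh
      · exact absurd hh hD.ne'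
    have had : a = d := by
      have hz := pow_eq_zero_iff (two_ne_zero) |>.1 hz1
      rw [hc] at hz
      have := (mul_eq_zero.1 (show E * (a - d) = 0 by linarith)).resolve_left hE.ne'
      linarith
    refine ⟨had, ?_, hc⟩
    rw [had, hc] at h
    exact (mul_eq_zero.1 (show b * E = 0 by linarith)).resolve_right hE.ne'

/-- The coefficients of the differential of the Birkhoff-Gauss map in a parametrization, together
with those of the metric given by the Hessian of the norm. -/
theorem IsBirkhoffGaussMap.exists_shape (hη : IsBirkhoffGaussMap N M η)
    (hN : IsMinkowskiNorm N) (hφ : IsLocalParam φ) (hx : x ∈ φ.source) :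
    ∃ a b c d E F G : ℝ,
      fderiv ℝ (fun y => η (embed φ y)) x (1, 0)
        = a • fderiv ℝ (embed φ) x (1, 0) + c • fderiv ℝ (embed φ) x (0, 1) ∧
      fderiv ℝ (fun y => η (embed φ y)) x (0, 1)
        = b • fderiv ℝ (embed φ) x (1, 0) + d • fderiv ℝ (embed φ) x (0, 1) ∧
      meanCurvature M η (embed φ x) = (a + d) / 2 ∧ gaussianCurvature M η (embed φ x) = a * d - b * c ∧
      0 < E ∧ 0 < E * G - F ^ 2 ∧ a * F + c * G = b * E + d * F ∧
      ∀ s t : ℝ, -fderiv ℝ N (η (embed φ x)) (fderiv ℝ (fderiv ℝ (embed φ)) x (s, t) (s, t))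
        = s ^ 2 * (a * E + c * F) + 2 * s * t * (a * F + c * G) + t ^ 2 * (b * F + d * G) := by
  obtain ⟨a, c, hu⟩ := hη.exists_comb hN hφ hx (hη.fderiv_fderiv_comp hN hφ hx (1, 0))
  obtain ⟨b, d, hv⟩ := hη.exists_comb hN hφ hx (hη.fderiv_fderiv_comp hN hφ hx (0, 1))
  set X := fderiv ℝ (embed φ) x (1, 0) with hX
  set Y := fderiv ℝ (embed φ) x (0, 1) with hY
  have hp := hη.norm_eq_one _ (φ x).2
  have hp0 := hη.ne_zero (φ x).2
  set B := fderiv ℝ (fderiv ℝ N) (η (embed φ x)) with hB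
  have hsymm : B Y X = B X Y := hN.hessian_symm hp0 _ _
  have hker : ∀ s t : ℝ, fderiv ℝ N (η (embed φ x)) (s • X + t • Y) = 0 := fun s t => by
    simp [hX, hY, hη.fderiv_embed hN hφ hx]
  have hpos : ∀ s t : ℝ, s ≠ 0 ∨ t ≠ 0 →
      0 < s ^ 2 * B X X + 2 * s * t * B X Y + t ^ 2 * B Y Y := by
    intro s t hst
    have h := hN.hessian_pos hp (hker s t) (fun h0 => by
      have := hφ.linearIndependent hx s t h0
      tauto)
    simp only [← hB, map_add, map_smul, add_apply, smul_apply, smul_eq_mul, hsymm] at h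
    linarith
  have hE : 0 < B X X := by simpa using hpos 1 0 (by simp)
  have h12 := hη.hessian_eq hN hφ hx (1, 0) (0, 1)
  have h21 := hη.hessian_eq hN hφ hx (0, 1) (1, 0)
  have h11 := hη.hessian_eq hN hφ hx (1, 0) (1, 0)
  have h22 := hη.hessian_eq hN hφ hx (0, 1) (0, 1)
  have hsw : fderiv ℝ (fderiv ℝ (embed φ)) x (1, 0) (0, 1)
      = fderiv ℝ (fderiv ℝ (embed φ)) x (0, 1) (1, 0) := by
    refine (hφ.contDiffAt hx).isSymmSndFDerivAt ?_ _ _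
    simp only [minSmoothness_of_isRCLikeNormedField]
    exact WithTop.coe_le_coe.2 (le_top : (2 : ℕ∞) ≤ ⊤)
  rw [hu] at h11 h12
  rw [hv] at h21 h22
  simp only [← hB, ← hX, ← hY, map_add, map_smul, add_apply, smul_apply, smul_eq_mul,
    hsymm] at h11 h12 h21 h22
  refine ⟨a, b, c, d, B X X, B X Y, B Y Y, hu, hv,
    hφ.meanCurvature_eq hx (hη.differentiableAt hN hφ hx) hu hv, ?_, hE, ?_, ?_, ?_⟩
  · exact hφ.gaussianCurvature_eq hx (hη.differentiableAt hN hφ hx) hu hv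
  -- At `(s, t) = (-F, E)` the form takes the value `E (EG - F²)`.
  · have h := hpos (-(B X Y)) (B X X) (Or.inr hE.ne')
    have : 0 < B X X * (B X X * B Y Y - B X Y ^ 2) := by linarith
    exact pos_of_mul_pos_right this hE.le
  -- Self-adjointness comes from the symmetry of the second derivatives of the parametrization.
  · rw [hsw] at h12
    linarith
  · intro s t
    rw [apply_eq_comb (fderiv ℝ (fderiv ℝ (embed φ)) x) (s, t), add_apply, smul_apply, smul_apply,
      apply_eq_comb (fderiv ℝ (fderiv ℝ (embed φ)) x (1, 0)) (s, t),
      apply_eq_comb (fderiv ℝ (fderiv ℝ (embed φ)) x (0, 1)) (s, t)]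
    rw [← hsw] at h21 ⊢
    simp only [map_add, map_smul, smul_eq_mul]
    linear_combination -s ^ 2 * h11 - 2 * s * t * h12 - t ^ 2 * h22

/-- The Gaussian curvature is the Jacobian of the Birkhoff-Gauss map. -/
theorem IsBirkhoffGaussMap.det3_fderiv (hη : IsBirkhoffGaussMap N M η)
    (hN : IsMinkowskiNorm N) (hφ : IsLocalParam φ) (hx : x ∈ φ.source) :
    det3 (fderiv ℝ (fun y => η (embed φ y)) x (1, 0))
        (fderiv ℝ (fun y => η (embed φ y)) x (0, 1)) (η (embed φ x))
      = gaussianCurvature M η (embed φ x) * det3 (fderiv ℝ (embed φ) x (1, 0))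
        (fderiv ℝ (embed φ) x (0, 1)) (η (embed φ x)) := by
  obtain ⟨a, b, c, d, E, F, G, hu, hv, -, hK, -⟩ := hη.exists_shape hN hφ hx
  rw [hu, hv, hK, det3_comb]

theorem IsBirkhoffGaussMap.gaussianCurvature_le (hη : IsBirkhoffGaussMap N M η)
    (hN : IsMinkowskiNorm N) (hφ : IsLocalParam φ) (hx : x ∈ φ.source) :
    gaussianCurvature M η (embed φ x) ≤ meanCurvature M η (embed φ x) ^ 2 := by
  obtain ⟨a, b, c, d, E, F, G, -, -, hH, hK, hE, hD, h, -⟩ := hη.exists_shape hN hφ hx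
  rw [hH, hK]
  exact (det_le_half_trace_sq hE hD h).1

theorem IsBirkhoffGaussMap.fderiv_eq_of_umbilic (hη : IsBirkhoffGaussMap N M η)
    (hN : IsMinkowskiNorm N) (hφ : IsLocalParam φ) (hx : x ∈ φ.source)
    (heq : gaussianCurvature M η (embed φ x) = meanCurvature M η (embed φ x) ^ 2) :
    fderiv ℝ (fun y => η (embed φ y)) x
      = meanCurvature M η (embed φ x) • fderiv ℝ (embed φ) x := by
  obtain ⟨a, b, c, d, E, F, G, hu, hv, hH, hK, hE, hD, h, -⟩ := hη.exists_shape hN hφ hx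
  rw [hH, hK] at heq
  obtain ⟨h1, h2, h3⟩ := (det_le_half_trace_sq hE hD h).2 heq
  refine ContinuousLinearMap.ext fun w => ?_
  rw [hH, smul_apply, apply_eq_comb _ w, hu, hv, apply_eq_comb (fderiv ℝ (embed φ) x) w,
    h1, h2, h3]
  module

theorem deriv_deriv_nonpos_of_isLocalMax {g : ℝ → ℝ} {t : ℝ} (h : IsLocalMax g t)
    (hg : ContinuousAt g t) : deriv (deriv g) t ≤ 0 := by
  by_contra! hpos
  -- A positive second derivative would make the maximum also a local minimum, so `g` would be
  -- locally constant.
  have hmin := isLocalMin_of_deriv_deriv_pos hpos h.deriv_eq_zero hg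
  have hconst : g =ᶠ[𝓝 t] fun _ => g t := by
    filter_upwards [h, hmin] with s h1 h2
    exact le_antisymm h1 h2
  have := hconst.deriv.deriv_eq
  simp at this
  exact hpos.ne' this

theorem IsLocalParam.second_deriv_nonpos (hφ : IsLocalParam φ) (hx : x ∈ φ.source)
    {l : E3 →L[ℝ] ℝ} (h : IsLocalMax (fun y => l (embed φ y)) x) (w : ℝ × ℝ) :
    l (fderiv ℝ (fderiv ℝ (embed φ)) x w w) ≤ 0 := by
  have hc : ContinuousAt (fun t : ℝ => x + t • w) 0 := by fun_prop
  have hc' : Tendsto (fun t : ℝ => x + t • w) (𝓝 0) (𝓝 x) := by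
    simpa using hc.tendsto
  have hsrc : ∀ᶠ t : ℝ in 𝓝 0, x + t • w ∈ φ.source :=
    hc'.eventually (φ.open_source.mem_nhds hx)
  set g : ℝ → ℝ := fun t => l (embed φ (x + t • w)) with hg
  have hderiv : ∀ t : ℝ, x + t • w ∈ φ.source →
      HasDerivAt g (l (fderiv ℝ (embed φ) (x + t • w) w)) t := by
    intro t ht
    have hl : HasDerivAt (fun s : ℝ => x + s • w) w t := by
      simpa using ((hasDerivAt_id t).smul_const w).const_add x
    have he := HasFDerivAt.comp_hasDerivAt (f := fun s : ℝ => x + s • w) t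
      (hφ.differentiableAt ht).hasFDerivAt hl
    exact l.hasFDerivAt.comp_hasDerivAt t he
  have h2 : DifferentiableAt ℝ (fderiv ℝ (embed φ)) x :=
    ((hφ.contDiffAt hx).fderiv_right (m := ∞) (by simp)).differentiableAt (by simp)
  have h3 : HasDerivAt (fun t : ℝ => l (fderiv ℝ (embed φ) (x + t • w) w))
      (l (fderiv ℝ (fderiv ℝ (embed φ)) x w w)) 0 :=
    l.hasFDerivAt.comp_hasDerivAt 0
      (((hasDerivAt_comp_line h2 w).clm_apply (hasDerivAt_const 0 w)).congr_deriv (by simp))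
  have h4 : deriv g =ᶠ[𝓝 0] fun t => l (fderiv ℝ (embed φ) (x + t • w) w) := by
    filter_upwards [hsrc] with t ht
    exact (hderiv t ht).deriv
  have hmax : IsLocalMax g 0 := by
    have := hc'.eventually h
    simpa [IsLocalMax, IsMaxFilter, hg] using this
  have h5 := deriv_deriv_nonpos_of_isLocalMax hmax
    (hderiv 0 (by simpa using hx)).continuousAt
  rwa [h4.deriv_eq, h3.deriv] at h5

theorem sq_le_mul_of_form_nonneg {P Q R : ℝ}
    (h : ∀ s t : ℝ, 0 ≤ s ^ 2 * P + 2 * s * t * Q + t ^ 2 * R) : Q * Q ≤ P * R := by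
  have := discrim_le_zero (a := P) (b := 2 * Q) (c := R) fun s => by
    have := h s 1
    linarith
  rw [discrim] at this
  linarith

/-- The curvature is nonnegative at the points where the conormal attains an extremum. -/
theorem IsBirkhoffGaussMap.gaussianCurvature_nonneg (hη : IsBirkhoffGaussMap N M η)
    (hN : IsMinkowskiNorm N) (hφ : IsLocalParam φ) (hx : x ∈ φ.source)
    (h : IsLocalExtr (fun y => fderiv ℝ N (η (embed φ x)) (embed φ y)) x) :
    0 ≤ gaussianCurvature M η (embed φ x) := by
  obtain ⟨a, b, c, d, E, F, G, -, -, -, hK, hE, hD, hs, hII⟩ := hη.exists_shape hN hφ hx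
  set l := fderiv ℝ N (η (embed φ x))
  -- The second fundamental form is semidefinite at an extremum of the conormal, so its determinant
  -- is nonnegative. As a matrix it is the metric times `dη`, so this determinant equals `(EG - F²)
  -- K`.
  have key : (a * F + c * G) * (a * F + c * G) ≤ (a * E + c * F) * (b * F + d * G) := by
    rcases h with h | h
    · have h' : IsLocalMax (fun y => (-l) (embed φ y)) x := h.neg
      have := sq_le_mul_of_form_nonneg (P := -(a * E + c * F)) (Q := -(a * F + c * G))
        (R := -(b * F + d * G)) fun s t => by
          have h1 := hφ.second_deriv_nonpos hx h' (s, t)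
          have h2 := hII s t
          rw [neg_apply] at h1
          linarith
      linarith
    · exact sq_le_mul_of_form_nonneg fun s t => by
        have h1 := hφ.second_deriv_nonpos hx h (s, t)
        have h2 := hII s t
        linarith
  rw [hK]
  have : 0 ≤ (E * G - F ^ 2) * (a * d - b * c) := by
    have : (a * F + c * G) * (a * F + c * G) = (a * F + c * G) * (b * E + d * F) := by rw [← hs]
    linarith
  exact nonneg_of_mul_nonneg_right this hD

theorem contDiffAt_det3 {E : Type*} [NormedAddCommGroup E] [NormedSpace ℝ E] {n : ℕ∞ω}
    {X Y Z : E → E3} {x : E} (hX : ContDiffAt ℝ n X x) (hY : ContDiffAt ℝ n Y x)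
    (hZ : ContDiffAt ℝ n Z x) : ContDiffAt ℝ n (fun y => det3 (X y) (Y y) (Z y)) x := by
  rw [contDiffAt_piLp] at hX hY hZ
  simp only [det3_eq]
  have := hX 0
  have := hX 1
  have := hX 2
  have := hY 0
  have := hY 1
  have := hY 2
  have := hZ 0
  have := hZ 1
  have := hZ 2
  fun_prop

theorem IsLocalParam.contDiffAt_fderiv (hφ : IsLocalParam φ) (hx : x ∈ φ.source) (w : ℝ × ℝ) :
    ContDiffAt ℝ ∞ (fun y => fderiv ℝ (embed φ) y w) x :=
  ((hφ.contDiffAt hx).fderiv_right (m := ∞) (by simp)).clm_apply contDiffAt_const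

theorem IsBirkhoffGaussMap.contDiffAt_fderiv (hη : IsBirkhoffGaussMap N M η)
    (hN : IsMinkowskiNorm N) (hφ : IsLocalParam φ) (hx : x ∈ φ.source) (w : ℝ × ℝ) :
    ContDiffAt ℝ ∞ (fun y => fderiv ℝ (fun z => η (embed φ z)) y w) x :=
  ((hη.contDiffAt hN hφ hx).fderiv_right (m := ∞) (by simp)).clm_apply contDiffAt_const

/-- By the Jacobian formula, `K` is `det(η_u, η_v, η)` divided by the nonvanishing `det(φ_u, φ_v,
η)`. -/
theorem IsBirkhoffGaussMap.contDiffAt_gaussianCurvature (hη : IsBirkhoffGaussMap N M η)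
    (hN : IsMinkowskiNorm N) (hφ : IsLocalParam φ) (hx : x ∈ φ.source) :
    ContDiffAt ℝ ∞ (fun y => gaussianCurvature M η (embed φ y)) x := by
  have h1 := (contDiffAt_det3 (hη.contDiffAt_fderiv hN hφ hx (1, 0))
    (hη.contDiffAt_fderiv hN hφ hx (0, 1)) (hη.contDiffAt hN hφ hx)).div
    (contDiffAt_det3 (hφ.contDiffAt_fderiv hx (1, 0)) (hφ.contDiffAt_fderiv hx (0, 1))
    (hη.contDiffAt hN hφ hx)) (hη.det3_ne_zero hN hφ hx)
  refine h1.congr_of_eventuallyEq ?_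
  filter_upwards [φ.open_source.mem_nhds hx] with y hy
  simp only [Pi.div_apply]
  rw [hη.det3_fderiv hN hφ hy, mul_div_cancel_right₀ _ (hη.det3_ne_zero hN hφ hy)]

/-- The trace is `det(η_u, φ_v, η) + det(φ_u, η_v, η)` divided by `det(φ_u, φ_v, η)`. -/
theorem IsBirkhoffGaussMap.contDiffAt_meanCurvature (hη : IsBirkhoffGaussMap N M η)
    (hN : IsMinkowskiNorm N) (hφ : IsLocalParam φ) (hx : x ∈ φ.source) :
    ContDiffAt ℝ ∞ (fun y => meanCurvature M η (embed φ y)) x := by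
  have h1 := (((contDiffAt_det3 (hη.contDiffAt_fderiv hN hφ hx (1, 0))
    (hφ.contDiffAt_fderiv hx (0, 1)) (hη.contDiffAt hN hφ hx)).add
    (contDiffAt_det3 (hφ.contDiffAt_fderiv hx (1, 0)) (hη.contDiffAt_fderiv hN hφ hx (0, 1))
      (hη.contDiffAt hN hφ hx))).div
    (contDiffAt_det3 (hφ.contDiffAt_fderiv hx (1, 0)) (hφ.contDiffAt_fderiv hx (0, 1))
    (hη.contDiffAt hN hφ hx)) (hη.det3_ne_zero hN hφ hx)).div_const 2
  refine h1.congr_of_eventuallyEq ?_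
  filter_upwards [φ.open_source.mem_nhds hx] with y hy
  obtain ⟨a, b, c, d, E, F, G, hu, hv, hH, -⟩ := hη.exists_shape hN hφ hy
  have hne := hη.det3_ne_zero hN hφ hy
  simp only [Pi.div_apply]
  rw [hH, hu, hv]
  congr 1
  rw [eq_div_iff hne]
  simp [det3_eq]
  ring

/-- A function on a closed surface which is continuous in all parametrizations is continuous. -/
theorem IsClosedSurface.continuousOn {F : Type*} [TopologicalSpace F] (hM : IsClosedSurface M)
    {f : E3 → F} (h : ∀ φ : OpenPartialHomeomorph (ℝ × ℝ) M, IsLocalParam φ →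
      ∀ x ∈ φ.source, ContinuousAt (fun y => f (embed φ y)) x) : ContinuousOn f M := by
  intro p hp
  obtain ⟨φ, hφ, hpt⟩ := hM.exists_param ⟨p, hp⟩
  have hx := φ.map_target hpt
  have hpe : embed φ (φ.symm ⟨p, hp⟩) = p := congrArg Subtype.val (φ.right_inv hpt)
  rw [← hpe, ContinuousWithinAt, ← map_embed_nhds hx, tendsto_map'_iff]
  exact h φ hφ _ hx

theorem IsBirkhoffGaussMap.continuousOn_meanCurvature (hη : IsBirkhoffGaussMap N M η)
    (hN : IsMinkowskiNorm N) (hM : IsClosedSurface M) :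
    ContinuousOn (meanCurvature M η) M :=
  hM.continuousOn fun _ hφ _ hx => (hη.contDiffAt_meanCurvature hN hφ hx).continuousAt

theorem IsBirkhoffGaussMap.continuousOn_gaussianCurvature (hη : IsBirkhoffGaussMap N M η)
    (hN : IsMinkowskiNorm N) (hM : IsClosedSurface M) :
    ContinuousOn (gaussianCurvature M η) M :=
  hM.continuousOn fun _ hφ _ hx => (hη.contDiffAt_gaussianCurvature hN hφ hx).continuousAt

/-- Where the Birkhoff-Gauss map is umbilic, it is locally a homothety. -/
theorem IsBirkhoffGaussMap.eventually_of_umbilic (hη : IsBirkhoffGaussMap N M η)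
    (hN : IsMinkowskiNorm N) (hφ : IsLocalParam φ) (hx : x ∈ φ.source)
    (h : ∀ᶠ y in 𝓝 x, gaussianCurvature M η (embed φ y) = meanCurvature M η (embed φ y) ^ 2) :
    ∀ᶠ y in 𝓝 x, meanCurvature M η (embed φ y) = meanCurvature M η (embed φ x) ∧
      η (embed φ y) - meanCurvature M η (embed φ x) • embed φ y
        = η (embed φ x) - meanCurvature M η (embed φ x) • embed φ x := by
  set H : ℝ × ℝ → ℝ := fun y => meanCurvature M η (embed φ y) with hH
  obtain ⟨ε, hε, hball⟩ := Metric.mem_nhds_iff.1 (h.and (φ.open_source.mem_nhds hx))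
  have hsrc : ∀ y ∈ Metric.ball x ε, y ∈ φ.source := fun y hy => (hball hy).2
  have hf : ∀ y ∈ Metric.ball x ε,
      fderiv ℝ (fun z => η (embed φ z)) y = H y • fderiv ℝ (embed φ) y := fun y hy =>
    hη.fderiv_eq_of_umbilic hN hφ (hsrc y hy) (hball hy).1
  have hHd : ∀ y ∈ Metric.ball x ε, DifferentiableAt ℝ H y := fun y hy =>
    (hη.contDiffAt_meanCurvature hN hφ (hsrc y hy)).differentiableAt (by simp)
  have hH0 : ∀ y ∈ Metric.ball x ε, fderiv ℝ H y = 0 := by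
    intro y hy
    have hys := hsrc y hy
    have h2 : HasFDerivAt (fderiv ℝ (embed φ)) (fderiv ℝ (fderiv ℝ (embed φ)) y) y :=
      (((hφ.contDiffAt hys).fderiv_right (m := ∞) (by simp)).differentiableAt
        (by simp)).hasFDerivAt
    have h3 : fderiv ℝ (fderiv ℝ (fun z => η (embed φ z))) y = _ :=
      (((hHd y hy).hasFDerivAt.smul h2).congr_of_eventuallyEq
      (by filter_upwards [Metric.isOpen_ball.mem_nhds hy] with z hz using hf z hz)).fderiv
    have hsf : IsSymmSndFDerivAt ℝ (fun z => η (embed φ z)) y := by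
      refine (hη.contDiffAt hN hφ hys).isSymmSndFDerivAt ?_
      simp only [minSmoothness_of_isRCLikeNormedField]
      exact WithTop.coe_le_coe.2 (le_top : (2 : ℕ∞) ≤ ⊤)
    have hsg : IsSymmSndFDerivAt ℝ (embed φ) y := by
      refine (hφ.contDiffAt hys).isSymmSndFDerivAt ?_
      simp only [minSmoothness_of_isRCLikeNormedField]
      exact WithTop.coe_le_coe.2 (le_top : (2 : ℕ∞) ≤ ⊤)
    -- Differentiate `dη = H dφ`. The symmetry of the second derivatives of `η` and `φ` leaves `H_u
    -- φ_v = H_v φ_u`, so `dH = 0` because `φ_u` and `φ_v` are independent.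
    have h4 := hsf (1, 0) (0, 1)
    rw [h3] at h4
    simp only [add_apply, smul_apply, ContinuousLinearMap.smulRight_apply,
      hsg (1, 0) (0, 1), add_right_inj] at h4
    have h5 := hφ.linearIndependent hys (-(fderiv ℝ H y (0, 1))) (fderiv ℝ H y (1, 0))
      (by rw [h4]; module)
    refine ContinuousLinearMap.ext fun w => ?_
    rw [apply_eq_comb, h5.2, neg_eq_zero.1 h5.1]
    simp
  have hHc : ∀ y ∈ Metric.ball x ε, H y = H x := fun y hy =>
    Metric.isOpen_ball.is_const_of_fderiv_eq_zero (convex_ball x ε).isPreconnected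
      (fun z hz => (hHd z hz).differentiableWithinAt) (fun z hz => hH0 z hz) hy
      (Metric.mem_ball_self hε)
  have hd : ∀ y ∈ Metric.ball x ε,
      HasFDerivAt (fun z => η (embed φ z) - H x • embed φ z) (0 : ℝ × ℝ →L[ℝ] E3) y := by
    intro y hy
    have h1 := (hη.differentiableAt hN hφ (hsrc y hy)).hasFDerivAt.sub
      ((hφ.differentiableAt (hsrc y hy)).hasFDerivAt.const_smul (H x))
    refine h1.congr_fderiv ?_
    rw [hf y hy, hHc y hy, sub_self]
  filter_upwards [Metric.ball_mem_nhds x hε] with y hy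
  refine ⟨hHc y hy, ?_⟩
  exact Metric.isOpen_ball.is_const_of_fderiv_eq_zero (convex_ball x ε).isPreconnected
      (fun z hz => (hd z hz).differentiableAt.differentiableWithinAt)
      (fun z hz => (hd z hz).fderiv) hy (Metric.mem_ball_self hε)

end GaussMap

/-! ### Volume of parametrized sets -/

/-- The identification of `ℝ³` with `ℝ² × ℝ`. -/
def splitEquiv : E3 ≃L[ℝ] (ℝ × ℝ) × ℝ :=
  LinearEquiv.toContinuousLinearEquiv
    { toFun := fun v => ((v 0, v 1), v 2)
      invFun := fun z => !₂[z.1.1, z.1.2, z.2]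
      map_add' := fun _ _ => rfl
      map_smul' := fun _ _ => rfl
      left_inv := fun v => by
        ext i
        fin_cases i <;> rfl
      right_inv := fun _ => rfl }

theorem splitEquiv_apply (v : E3) : splitEquiv v = ((v 0, v 1), v 2) := rfl

theorem measurePreserving_splitEquiv : MeasurePreserving splitEquiv volume volume := by
  have h1 := EuclideanSpace.volume_preserving_symm_measurableEquiv_toLp (Fin 3)
  have h2 := volume_preserving_piFinSuccAbove (fun _ : Fin 3 => ℝ) 2
  have h3 : MeasurePreserving (Prod.swap : ℝ × (Fin 2 → ℝ) → (Fin 2 → ℝ) × ℝ) volume volume :=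
    Measure.measurePreserving_swap
  have h4 : MeasurePreserving (Prod.map (MeasurableEquiv.finTwoArrow (α := ℝ)) (id : ℝ → ℝ))
      (volume : Measure ((Fin 2 → ℝ) × ℝ)) volume :=
    (volume_preserving_finTwoArrow ℝ).prod (MeasurePreserving.id volume)
  exact h4.comp (h3.comp (h2.comp h1))

theorem measurableEmbedding_splitEquiv : MeasurableEmbedding splitEquiv :=
  splitEquiv.toHomeomorph.measurableEmbedding

theorem det_comp_splitEquiv (L : (ℝ × ℝ) × ℝ →L[ℝ] E3) :
    (L.comp (splitEquiv : E3 →L[ℝ] (ℝ × ℝ) × ℝ)).det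
      = det3 (L ((1, 0), 0)) (L ((0, 1), 0)) (L ((0, 0), 1)) := by
  have : (L.comp (splitEquiv : E3 →L[ℝ] (ℝ × ℝ) × ℝ)).det = LinearMap.det
    (L.comp (splitEquiv : E3 →L[ℝ] (ℝ × ℝ) × ℝ) : E3 →ₗ[ℝ] E3) := rfl
  rw [this, ← LinearMap.det_toMatrix (EuclideanSpace.basisFun (Fin 3) ℝ).toBasis,
    Matrix.det_fin_three, det3_eq]
  simp [LinearMap.toMatrix_apply, splitEquiv_apply]
  ring

section Volume

variable {Φ : (ℝ × ℝ) × ℝ → E3} {Φ' : (ℝ × ℝ) × ℝ → (ℝ × ℝ) × ℝ →L[ℝ] E3} {S : Set ((ℝ × ℝ) × ℝ)}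

theorem lintegral_splitEquiv (Φ' : (ℝ × ℝ) × ℝ → (ℝ × ℝ) × ℝ →L[ℝ] E3) (S : Set ((ℝ × ℝ) × ℝ)) :
    ∫⁻ v in splitEquiv ⁻¹' S, ENNReal.ofReal
        |((Φ' (splitEquiv v)).comp (splitEquiv : E3 →L[ℝ] (ℝ × ℝ) × ℝ)).det|
      = ∫⁻ z in S, ENNReal.ofReal
        |det3 (Φ' z ((1, 0), 0)) (Φ' z ((0, 1), 0)) (Φ' z ((0, 0), 1))| := by
  rw [← measurePreserving_splitEquiv.setLIntegral_comp_preimage_emb measurableEmbedding_splitEquiv]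
  simp only [det_comp_splitEquiv]

theorem image_splitEquiv (Φ : (ℝ × ℝ) × ℝ → E3) (S : Set ((ℝ × ℝ) × ℝ)) :
    (fun v => Φ (splitEquiv v)) '' (splitEquiv ⁻¹' S) = Φ '' S := by
  rw [← Set.image_image Φ splitEquiv, Set.image_preimage_eq _ splitEquiv.surjective]

/-- Injectivity is not required for this inequality, since the integral counts multiplicity. It can
therefore be applied to the Birkhoff–Gauss map, which may overlap itself. -/
theorem volume_image_le (hS : MeasurableSet S) (hΦ : ∀ z ∈ S, HasFDerivAt Φ (Φ' z) z) :
    volume (Φ '' S) ≤ ∫⁻ z in S, ENNReal.ofReal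
      |det3 (Φ' z ((1, 0), 0)) (Φ' z ((0, 1), 0)) (Φ' z ((0, 0), 1))| := by
  rw [← image_splitEquiv, ← lintegral_splitEquiv]
  refine addHaar_image_le_lintegral_abs_det_fderiv volume
    (hS.preimage measurableEmbedding_splitEquiv.measurable) fun v hv => ?_
  exact ((hΦ _ hv).comp v splitEquiv.hasFDerivAt).hasFDerivWithinAt

theorem volume_image_eq (hS : MeasurableSet S) (hΦ : ∀ z ∈ S, HasFDerivAt Φ (Φ' z) z)
    (hinj : Set.InjOn Φ S) :
    volume (Φ '' S) = ∫⁻ z in S, ENNReal.ofReal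
      |det3 (Φ' z ((1, 0), 0)) (Φ' z ((0, 1), 0)) (Φ' z ((0, 0), 1))| := by
  rw [← image_splitEquiv, ← lintegral_splitEquiv]
  refine (lintegral_abs_det_fderiv_eq_addHaar_image volume
    (hS.preimage measurableEmbedding_splitEquiv.measurable) (fun v hv => ?_) ?_).symm
  · exact ((hΦ _ hv).comp v splitEquiv.hasFDerivAt).hasFDerivWithinAt
  · exact fun v hv w hw h => splitEquiv.injective (hinj hv hw h)

end Volume

/-! ### Cones with vertex at the origin -/

/-- The open cone with vertex `0` over `Q`. -/
def coneOver (Q : Set E3) : Set E3 := {z | ∃ q ∈ Q, ∃ t ∈ Set.Ioo (0 : ℝ) 1, z = t • q}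

theorem coneOver_union (P Q : Set E3) : coneOver (P ∪ Q) = coneOver P ∪ coneOver Q := by
  ext z
  simp only [coneOver, Set.mem_union, Set.mem_ofPred_eq]
  constructor
  · rintro ⟨q, hq | hq, h⟩
    exacts [Or.inl ⟨q, hq, h⟩, Or.inr ⟨q, hq, h⟩]
  · rintro (⟨q, hq, h⟩ | ⟨q, hq, h⟩)
    exacts [⟨q, Or.inl hq, h⟩, ⟨q, Or.inr hq, h⟩]

section Cone

variable {g : ℝ × ℝ → E3} {U A : Set (ℝ × ℝ)}

theorem hasFDerivAt_cone {z : (ℝ × ℝ) × ℝ} (hg : DifferentiableAt ℝ g z.1) :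
    HasFDerivAt (fun z : (ℝ × ℝ) × ℝ => z.2 • g z.1)
      (z.2 • (fderiv ℝ g z.1).comp (ContinuousLinearMap.fst ℝ (ℝ × ℝ) ℝ)
        + (ContinuousLinearMap.snd ℝ (ℝ × ℝ) ℝ).smulRight (g z.1)) z :=
  hasFDerivAt_snd.smul (hg.hasFDerivAt.comp z hasFDerivAt_fst)

theorem image_cone : (fun z : (ℝ × ℝ) × ℝ => z.2 • g z.1) '' (A ×ˢ Set.Ioo 0 1)
    = coneOver (g '' A) := by
  ext z
  constructor
  · rintro ⟨⟨x, t⟩, ⟨hx, ht⟩, rfl⟩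
    exact ⟨g x, ⟨x, hx, rfl⟩, t, ht, rfl⟩
  · rintro ⟨_, ⟨x, hx, rfl⟩, t, ht, rfl⟩
    exact ⟨(x, t), ⟨hx, ht⟩, rfl⟩

theorem continuousOn_det3 {X Y Z : ℝ × ℝ → E3} (hX : ContinuousOn X U)
    (hY : ContinuousOn Y U) (hZ : ContinuousOn Z U) :
    ContinuousOn (fun x => det3 (X x) (Y x) (Z x)) U := by
  simp only [det3_eq]
  fun_prop

theorem aemeasurable_det3 {X Y Z : ℝ × ℝ → E3} (hU : IsOpen U) (hX : ContinuousOn X U)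
    (hY : ContinuousOn Y U) (hZ : ContinuousOn Z U) (hA : A ⊆ U) :
    AEMeasurable (fun x => ENNReal.ofReal |det3 (X x) (Y x) (Z x)|) (volume.restrict A) := by
  exact ((ENNReal.continuous_ofReal.comp_continuousOn (continuousOn_det3 hX hY hZ).abs).aemeasurable hU.measurableSet).mono_measure (Measure.restrict_mono hA le_rfl)

/-- Two of the columns carry a factor `t`, so the Jacobian of `(x, t) ↦ t g(x)` is `t²` times its
value at `t = 1`, and `∫₀¹ t² dt = 1/3`. -/
theorem lintegral_cone (hU : IsOpen U) (hg : ContDiffOn ℝ ∞ g U) (hA : A ⊆ U) :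
    ∫⁻ z in A ×ˢ Set.Ioo (0 : ℝ) 1, ENNReal.ofReal |det3 (z.2 • fderiv ℝ g z.1 (1, 0))
        (z.2 • fderiv ℝ g z.1 (0, 1)) (g z.1)|
      = ENNReal.ofReal (1 / 3) * ∫⁻ x in A, ENNReal.ofReal
        |det3 (fderiv ℝ g x (1, 0)) (fderiv ℝ g x (0, 1)) (g x)| := by
  have h1 : ∀ z : (ℝ × ℝ) × ℝ, ENNReal.ofReal |det3 (z.2 • fderiv ℝ g z.1 (1, 0))
        (z.2 • fderiv ℝ g z.1 (0, 1)) (g z.1)|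
      = ENNReal.ofReal |det3 (fderiv ℝ g z.1 (1, 0)) (fderiv ℝ g z.1 (0, 1)) (g z.1)|
        * ENNReal.ofReal (z.2 ^ 2) := by
    intro z
    rw [← ENNReal.ofReal_mul (abs_nonneg _), ← abs_of_nonneg (sq_nonneg z.2), ← abs_mul]
    congr 2
    simp [det3_eq]
    ring
  have hI : ∫⁻ t in Set.Ioo (0 : ℝ) 1, ENNReal.ofReal (t ^ 2) = ENNReal.ofReal (1 / 3) := by
    rw [← ofReal_integral_eq_lintegral_ofReal, ← integral_Ioc_eq_integral_Ioo,
      ← intervalIntegral.integral_of_le zero_le_one, integral_pow]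
    · norm_num
    · exact ((continuous_pow 2).integrableOn_Icc).mono_set Set.Ioo_subset_Icc_self
    · exact Eventually.of_forall fun t => sq_nonneg t
  have hfd := hg.continuousOn_fderiv_of_isOpen hU (by simp)
  simp only [h1]
  rw [Measure.volume_eq_prod, ← Measure.prod_restrict, lintegral_prod_mul
    (f := fun x => ENNReal.ofReal |det3 (fderiv ℝ g x (1, 0)) (fderiv ℝ g x (0, 1)) (g x)|)
    (g := fun t => ENNReal.ofReal (t ^ 2)), hI, mul_comm]
  · exact aemeasurable_det3 hU (hfd.clm_apply continuousOn_const)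
      (hfd.clm_apply continuousOn_const) hg.continuousOn hA
  · fun_prop

theorem volume_coneOver_le (hU : IsOpen U) (hg : ContDiffOn ℝ ∞ g U) (hA : A ⊆ U)
    (hAm : MeasurableSet A) :
    volume (coneOver (g '' A)) ≤ ENNReal.ofReal (1 / 3) * ∫⁻ x in A, ENNReal.ofReal
        |det3 (fderiv ℝ g x (1, 0)) (fderiv ℝ g x (0, 1)) (g x)| := by
  rw [← image_cone, ← lintegral_cone hU hg hA]
  refine (volume_image_le (hAm.prod measurableSet_Ioo) fun z hz => hasFDerivAt_cone
    ((hg.contDiffAt (hU.mem_nhds (hA hz.1))).differentiableAt (by simp))).trans_eq ?_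
  simp [show ((0 : ℝ), (0 : ℝ)) = 0 from rfl]

theorem volume_coneOver_eq (hU : IsOpen U) (hg : ContDiffOn ℝ ∞ g U) (hA : A ⊆ U)
    (hAm : MeasurableSet A)
    (hinj : Set.InjOn (fun z : (ℝ × ℝ) × ℝ => z.2 • g z.1) (A ×ˢ Set.Ioo 0 1)) :
    volume (coneOver (g '' A)) = ENNReal.ofReal (1 / 3) * ∫⁻ x in A, ENNReal.ofReal
        |det3 (fderiv ℝ g x (1, 0)) (fderiv ℝ g x (0, 1)) (g x)| := by
  rw [← image_cone, ← lintegral_cone hU hg hA]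
  refine (volume_image_eq (hAm.prod measurableSet_Ioo) (fun z hz => hasFDerivAt_cone
    ((hg.contDiffAt (hU.mem_nhds (hA hz.1))).differentiableAt (by simp))) hinj).trans ?_
  simp [show ((0 : ℝ), (0 : ℝ)) = 0 from rfl]

end Cone

/-! ### The area measure -/

section Area

variable {N : Seminorm ℝ E3} {M : Set E3} {η : E3 → E3}
  {φ ψ : OpenPartialHomeomorph (ℝ × ℝ) M}

/-- The density of the area element in a local parametrization. -/
def areaDensity (η : E3 → E3) (φ : OpenPartialHomeomorph (ℝ × ℝ) M) (x : ℝ × ℝ) : ℝ≥0∞ :=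
  ENNReal.ofReal |det3 (fderiv ℝ (embed φ) x (1, 0)) (fderiv ℝ (embed φ) x (0, 1))
    (η (embed φ x))|

theorem IsLocalParam.continuousOn_fderiv (hφ : IsLocalParam φ) :
    ContinuousOn (fderiv ℝ (embed φ)) φ.source :=
  ContDiffOn.continuousOn_fderiv_of_isOpen hφ.smooth φ.open_source (by simp)

theorem mapsTo_embed : Set.MapsTo (embed φ) φ.source M := fun x _ => (φ x).2

theorem IsLocalParam.continuousOn_areaDensity (hφ : IsLocalParam φ) (hη : ContinuousOn η M) :
    ContinuousOn (areaDensity η φ) φ.source := by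
  have h1 := hφ.continuousOn_fderiv
  have hX : ContinuousOn (fun x => fderiv ℝ (embed φ) x (1, 0)) φ.source :=
    h1.clm_apply continuousOn_const
  have hY : ContinuousOn (fun x => fderiv ℝ (embed φ) x (0, 1)) φ.source :=
    h1.clm_apply continuousOn_const
  have hZ : ContinuousOn (fun x => η (embed φ x)) φ.source :=
    hη.comp hφ.smooth.continuousOn mapsTo_embed
  exact ENNReal.continuous_ofReal.comp_continuousOn (continuousOn_det3 hX hY hZ).abs

open Classical in
/-- A measurable map that agrees with a local parametrization on its domain. -/
def measurableEmbed (φ : OpenPartialHomeomorph (ℝ × ℝ) M) : ℝ × ℝ → E3 :=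
  φ.source.piecewise (embed φ) 0

theorem IsLocalParam.measurable_measurableEmbed (hφ : IsLocalParam φ) :
    Measurable (measurableEmbed φ) := by
  classical
  exact hφ.smooth.continuousOn.measurable_piecewise continuousOn_const φ.open_source.measurableSet

theorem measurableEmbed_of_mem {x : ℝ × ℝ} (hx : x ∈ φ.source) :
    measurableEmbed φ x = embed φ x := by
  classical
  exact Set.piecewise_eq_of_mem _ _ _ hx

theorem source_inter_preimage (B : Set E3) :
    φ.source ∩ embed φ ⁻¹' B = measurableEmbed φ ⁻¹' B ∩ φ.source := by
  ext x
  constructor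
  · rintro ⟨hx, hB⟩
    refine ⟨?_, hx⟩
    rw [Set.mem_preimage, measurableEmbed_of_mem hx]
    exact hB
  · rintro ⟨hB, hx⟩
    refine ⟨hx, ?_⟩
    rw [Set.mem_preimage, measurableEmbed_of_mem hx] at hB
    exact hB

theorem IsLocalParam.measurableSet_inter (hφ : IsLocalParam φ) {B : Set E3}
    (hB : MeasurableSet B) : MeasurableSet (φ.source ∩ embed φ ⁻¹' B) := by
  rw [source_inter_preimage]
  exact (hφ.measurable_measurableEmbed hB).inter φ.open_source.measurableSet

/-- Outside `φ.source` the map `embed φ` is arbitrary, but the measure vanishes there, so a globally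
measurable map can replace it. -/
theorem patchMeasure_eq :
    patchMeasure η φ
      = ((volume.restrict φ.source).withDensity (areaDensity η φ)).map (measurableEmbed φ) := by
  refine Measure.map_congr ?_
  refine (withDensity_absolutelyContinuous _ _).ae_le ?_
  filter_upwards [ae_restrict_mem φ.open_source.measurableSet] with x hx
  exact (measurableEmbed_of_mem hx).symm

theorem IsLocalParam.patchMeasure_apply (hφ : IsLocalParam φ) {B : Set E3}
    (hB : MeasurableSet B) :
    patchMeasure η φ B = ∫⁻ x in φ.source ∩ embed φ ⁻¹' B, areaDensity η φ x := by
  rw [patchMeasure_eq, Measure.map_apply hφ.measurable_measurableEmbed hB,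
    withDensity_apply _ (hφ.measurable_measurableEmbed hB),
    Measure.restrict_restrict (hφ.measurable_measurableEmbed hB), source_inter_preimage]

theorem IsLocalParam.setLIntegral_patchMeasure (hφ : IsLocalParam φ) (hη : ContinuousOn η M)
    (hM : MeasurableSet M) {F : E3 → ℝ≥0∞} (hF : ContinuousOn F M) {B : Set E3}
    (hB : MeasurableSet B) (hBM : B ⊆ M) :
    ∫⁻ p in B, F p ∂(patchMeasure η φ)
      = ∫⁻ x in φ.source ∩ embed φ ⁻¹' B, areaDensity η φ x * F (embed φ x) := by
  classical
  set F' : E3 → ℝ≥0∞ := M.piecewise F 0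
  have hF' : Measurable F' := hF.measurable_piecewise continuousOn_const hM
  have h1 : ∫⁻ p in B, F p ∂(patchMeasure η φ) = ∫⁻ p in B, F' p ∂(patchMeasure η φ) :=
    setLIntegral_congr_fun hB fun p hp => (Set.piecewise_eq_of_mem _ _ _ (hBM hp)).symm
  have hm := hφ.measurable_measurableEmbed
  rw [h1, patchMeasure_eq, setLIntegral_map hB hF' hm,
    setLIntegral_withDensity_eq_lintegral_mul₀ (g := fun x => F' (measurableEmbed φ x))
      ((hφ.continuousOn_areaDensity hη).aemeasurable φ.open_source.measurableSet)
      (hF'.comp hm).aemeasurable (hm hB),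
    Measure.restrict_restrict (hm hB), ← source_inter_preimage]
  refine setLIntegral_congr_fun (hφ.measurableSet_inter hB) fun x hx => ?_
  have : F' (measurableEmbed φ x) = F (embed φ x) := by
    rw [measurableEmbed_of_mem hx.1]
    exact Set.piecewise_eq_of_mem _ _ _ (φ x).2
  simp only [Pi.mul_apply, this]

theorem IsLocalParam.patchMeasure_le (hφ : IsLocalParam φ) :
    patchMeasure η φ ≤ areaMeasure M η :=
  le_iSup₂ (f := fun (φ : OpenPartialHomeomorph (ℝ × ℝ) M) (_ : IsLocalParam φ) =>
    patchMeasure η φ) φ hφ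

theorem areaMeasure_le {μ : Measure E3}
    (h : ∀ φ : OpenPartialHomeomorph (ℝ × ℝ) M, IsLocalParam φ → patchMeasure η φ ≤ μ) :
    areaMeasure M η ≤ μ :=
  iSup₂_le h

theorem areaMeasure_restrict (hM : MeasurableSet M) :
    (areaMeasure M η).restrict M = areaMeasure M η := by
  refine le_antisymm Measure.restrict_le_self (areaMeasure_le fun φ hφ => ?_)
  have h1 : (patchMeasure η φ).restrict M = patchMeasure η φ := by
    refine Measure.restrict_eq_self_of_ae_mem ?_
    rw [ae_iff]
    change patchMeasure η φ Mᶜ = 0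
    rw [hφ.patchMeasure_apply hM.compl]
    have : φ.source ∩ embed φ ⁻¹' Mᶜ = ∅ := by
      ext x
      simp
    rw [this, Measure.restrict_empty, lintegral_zero_measure]
  rw [← h1]
  exact Measure.restrict_mono le_rfl hφ.patchMeasure_le

end Area

/-! ### Independence of the parametrization, and the cone estimate for the Gauss image -/

section Compatibility

variable {N : Seminorm ℝ E3} {M : Set E3} {η : E3 → E3}
  {φ ψ : OpenPartialHomeomorph (ℝ × ℝ) M}

theorem exists_isOpen_image_embed (φ : OpenPartialHomeomorph (ℝ × ℝ) M) :
    ∃ O : Set E3, IsOpen O ∧ embed φ '' φ.source = M ∩ O := by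
  obtain ⟨O, hO, hOt⟩ := isOpen_induced_iff.1 φ.open_target
  refine ⟨O, hO, ?_⟩
  have : embed φ '' φ.source = Subtype.val '' φ.target := by
    rw [← φ.image_source_eq_target, Set.image_image]
  rw [this, ← hOt, Subtype.image_preimage_coe]

theorem measurableSet_image_embed (hM : MeasurableSet M) :
    MeasurableSet (embed φ '' φ.source) := by
  obtain ⟨O, hO, h⟩ := exists_isOpen_image_embed φ
  rw [h]
  exact hM.inter hO.measurableSet

theorem det_prod_clm (L : ℝ × ℝ →L[ℝ] ℝ × ℝ) :
    L.det = (L (1, 0)).1 * (L (0, 1)).2 - (L (0, 1)).1 * (L (1, 0)).2 := by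
  have : L.det = LinearMap.det (L : ℝ × ℝ →ₗ[ℝ] ℝ × ℝ) := rfl
  rw [this, ← LinearMap.det_toMatrix (Module.Basis.finTwoProd ℝ), Matrix.det_fin_two]
  simp [LinearMap.toMatrix_apply]

/-- The transition map between two parametrizations is differentiable. -/
theorem IsLocalParam.exists_transition (hφ : IsLocalParam φ) (hψ : IsLocalParam ψ) {x : ℝ × ℝ}
    (hx : x ∈ φ.source) (hxt : φ x ∈ ψ.target) :
    ∃ L : ℝ × ℝ →L[ℝ] ℝ × ℝ, HasFDerivAt (fun y => ψ.symm (φ y)) L x ∧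
      areaDensity η φ x = ENNReal.ofReal |L.det| * areaDensity η ψ (ψ.symm (φ x)) := by
  set τ : ℝ × ℝ → ℝ × ℝ := fun y => ψ.symm (φ y) with hτ
  have hτx : τ x ∈ ψ.source := ψ.map_target hxt
  have heq : embed ψ (τ x) = embed φ x := congrArg Subtype.val (ψ.right_inv hxt)
  obtain ⟨G, hG, hGψ⟩ := hψ.exists_retraction hτx
  have hcont : ContinuousAt τ x := (ψ.continuousAt_symm hxt).comp (φ.continuousAt hx)
  have hev : ∀ᶠ y in 𝓝 x, φ y ∈ ψ.target :=
    (φ.continuousAt hx).eventually (ψ.open_target.mem_nhds hxt)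
  have hemb : ∀ᶠ y in 𝓝 x, embed ψ (τ y) = embed φ y := by
    filter_upwards [hev] with y hy
    exact congrArg Subtype.val (ψ.right_inv hy)
  -- The transition map is a priori only continuous; the retraction for `ψ` exhibits it as a
  -- composition of differentiable maps.
  have h1 : τ =ᶠ[𝓝 x] fun y => G (embed φ y) := by
    filter_upwards [hcont.eventually hGψ, hemb] with y hy1 hy2
    rw [← hy2, hy1]
  have h2 : DifferentiableAt ℝ τ x := by
    refine (DifferentiableAt.comp (f := embed φ) (g := G) x ?_
      (hφ.differentiableAt hx)).congr_of_eventuallyEq h1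
    rw [← heq]
    exact hG.differentiableAt (by simp)
  refine ⟨fderiv ℝ τ x, h2.hasFDerivAt, ?_⟩
  have h3 : HasFDerivAt (fun y => embed ψ (τ y)) _ x :=
    HasFDerivAt.comp (f := τ) (g := embed ψ) x (hψ.differentiableAt hτx).hasFDerivAt
      h2.hasFDerivAt
  have h4 := (h3.congr_of_eventuallyEq (hemb.mono fun y hy => hy.symm)).fderiv
  rw [areaDensity, areaDensity, ← ENNReal.ofReal_mul (abs_nonneg _), ← abs_mul, h4, heq]
  congr 2
  rw [ContinuousLinearMap.comp_apply, ContinuousLinearMap.comp_apply,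
    apply_eq_comb _ (fderiv ℝ τ x (1, 0)), apply_eq_comb _ (fderiv ℝ τ x (0, 1)), det3_comb,
    det_prod_clm]

/-- Change of variables along the transition map. An inequality is enough, because the area measure
is a supremum of patches. -/
theorem IsLocalParam.patchMeasure_apply_le (hφ : IsLocalParam φ) (hψ : IsLocalParam ψ)
    {B : Set E3} (hB : MeasurableSet B) (hBψ : B ⊆ embed ψ '' ψ.source) :
    patchMeasure η φ B ≤ patchMeasure η ψ B := by
  rw [hφ.patchMeasure_apply hB, hψ.patchMeasure_apply hB]
  set A := φ.source ∩ embed φ ⁻¹' B with hA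
  have hAt : ∀ x ∈ A, φ x ∈ ψ.target := by
    rintro x ⟨-, hxB⟩
    obtain ⟨y, hy, hyx⟩ := hBψ hxB
    rw [show φ x = ψ y from Subtype.ext hyx.symm]
    exact ψ.map_source hy
  have hex : ∀ x : ℝ × ℝ, ∃ L : ℝ × ℝ →L[ℝ] ℝ × ℝ, x ∈ A →
      HasFDerivAt (fun y => ψ.symm (φ y)) L x ∧
      areaDensity η φ x = ENNReal.ofReal |L.det| * areaDensity η ψ (ψ.symm (φ x)) := by
    intro x
    by_cases hx : x ∈ A
    · obtain ⟨L, hL⟩ := hφ.exists_transition hψ (η := η) hx.1 (hAt x hx)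
      exact ⟨L, fun _ => hL⟩
    · exact ⟨0, fun h => absurd h hx⟩
  choose L hL using hex
  have hAm : MeasurableSet A := hφ.measurableSet_inter hB
  have h1 : ∫⁻ x in A, areaDensity η φ x
      = ∫⁻ x in A, ENNReal.ofReal |(L x).det| * areaDensity η ψ (ψ.symm (φ x)) :=
    setLIntegral_congr_fun hAm fun x hx => (hL x hx).2
  have hinj : Set.InjOn (fun y => ψ.symm (φ y)) A := fun x hx y hy h =>
    φ.injOn hx.1 hy.1 (ψ.symm.injOn (hAt x hx) (hAt y hy) h)
  rw [h1, ← lintegral_image_eq_lintegral_abs_det_fderiv_mul volume hAm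
    (fun x hx => (hL x hx).1.hasFDerivWithinAt) hinj]
  refine lintegral_mono_set ?_
  rintro _ ⟨x, hx, rfl⟩
  refine ⟨ψ.map_target (hAt x hx), ?_⟩
  have : embed ψ (ψ.symm (φ x)) = embed φ x := congrArg Subtype.val (ψ.right_inv (hAt x hx))
  rw [Set.mem_preimage, this]
  exact hx.2

/-- A supremum of measures is not computed set by set. It is bounded by an explicit measure
dominating all patches: the patch of `ψ`, plus the area measure restricted to the complement of the
image of `ψ`. -/
theorem IsLocalParam.areaMeasure_apply_le (hψ : IsLocalParam ψ) (hM : MeasurableSet M)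
    {B : Set E3} (hB : MeasurableSet B) (hBψ : B ⊆ embed ψ '' ψ.source) :
    areaMeasure M η B ≤ patchMeasure η ψ B := by
  set T := embed ψ '' ψ.source
  have hT : MeasurableSet T := measurableSet_image_embed hM
  have h1 : areaMeasure M η ≤ patchMeasure η ψ + (areaMeasure M η).restrict Tᶜ := by
    refine areaMeasure_le fun φ hφ => Measure.le_iff.2 fun s hs => ?_
    rw [← measure_inter_add_sdiff s hT, Measure.add_apply, Measure.restrict_apply hs]
    refine add_le_add ?_ (hφ.patchMeasure_le _)
    exact (hφ.patchMeasure_apply_le hψ (hs.inter hT) Set.inter_subset_right).trans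
      (measure_mono Set.inter_subset_left)
  refine (h1 B).trans ?_
  rw [Measure.add_apply, Measure.restrict_apply hB]
  have : B ∩ Tᶜ = ∅ := by
    ext x
    simp only [Set.mem_inter_iff, Set.mem_compl_iff, Set.mem_empty_iff_false, iff_false, not_and,
      not_not]
    exact fun hx => hBψ hx
  rw [this, measure_empty, add_zero]

theorem IsClosedSurface.measurableSet (hM : IsClosedSurface M) : MeasurableSet M :=
  hM.isCompact.measurableSet

theorem setLIntegral_lt_top_of_isCompact_of_continuousOn {X : Type*} [TopologicalSpace X]
    [MeasurableSpace X] {μ : Measure X} {K : Set X} (hK : IsCompact K)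
    (hμ : μ K < ⊤) {f : X → ℝ} (hf : ContinuousOn f K) :
    ∫⁻ x in K, ENNReal.ofReal (f x) ∂μ < ⊤ := by
  obtain ⟨C, hC⟩ := hK.bddAbove_image hf
  calc ∫⁻ x in K, ENNReal.ofReal (f x) ∂μ ≤ ∫⁻ x in K, ENNReal.ofReal C ∂μ :=
        setLIntegral_mono_ae (by fun_prop) (Eventually.of_forall fun x hx =>
          ENNReal.ofReal_le_ofReal (hC ⟨x, hx, rfl⟩))
    _ = ENNReal.ofReal C * μ K := by rw [setLIntegral_const]
    _ < ⊤ := ENNReal.mul_lt_top ENNReal.ofReal_lt_top hμ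

theorem IsClosedSurface.areaMeasure_lt_top (hM : IsClosedSurface M) (hη : ContinuousOn η M) :
    areaMeasure M η M < ⊤ := by
  refine hM.isCompact.measure_lt_top_of_nhdsWithin fun p hp => ?_
  obtain ⟨φ, hφ, hpt⟩ := hM.exists_param ⟨p, hp⟩
  have hx := φ.map_target hpt
  have hpe : embed φ (φ.symm ⟨p, hp⟩) = p := congrArg Subtype.val (φ.right_inv hpt)
  set x := φ.symm ⟨p, hp⟩
  obtain ⟨ε, hε, hball⟩ := Metric.nhds_basis_closedBall.mem_iff.1 (φ.open_source.mem_nhds hx)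
  set K := Metric.closedBall x ε
  have hK : IsCompact K := isCompact_closedBall x ε
  have hKim : IsCompact (embed φ '' K) := hK.image_of_continuousOn
    (hφ.smooth.continuousOn.mono hball)
  refine ⟨embed φ '' K, ?_, ?_⟩
  · rw [← hpe, ← map_embed_nhds hx]
    exact image_mem_map (Metric.closedBall_mem_nhds x hε)
  · refine (hφ.areaMeasure_apply_le hM.measurableSet hKim.measurableSet
      (Set.image_mono hball)).trans_lt ?_
    rw [hφ.patchMeasure_apply hKim.measurableSet]
    have : φ.source ∩ embed φ ⁻¹' (embed φ '' K) ⊆ K := by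
      rintro y ⟨hy, z, hz, hzy⟩
      rwa [← embed_injOn (hball hz) hy hzy]
    refine (lintegral_mono_set this).trans_lt ?_
    refine setLIntegral_lt_top_of_isCompact_of_continuousOn hK
      hK.measure_lt_top ?_
    have h1 := hφ.continuousOn_fderiv.mono hball
    have hX : ContinuousOn (fun x => fderiv ℝ (embed φ) x (1, 0)) K :=
      h1.clm_apply continuousOn_const
    have hY : ContinuousOn (fun x => fderiv ℝ (embed φ) x (0, 1)) K :=
      h1.clm_apply continuousOn_const
    have hZ : ContinuousOn (fun x => η (embed φ x)) K :=
      hη.comp (hφ.smooth.continuousOn.mono hball) fun x _ => (φ x).2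
    exact (continuousOn_det3 hX hY hZ).abs

/-- To prove a finitely additive property of measurable subsets of a closed surface, it suffices
to consider sets covered by one parametrization. -/
theorem IsClosedSurface.induction_on (hM : IsClosedSurface M) {P : Set E3 → Prop}
    (small : ∀ φ : OpenPartialHomeomorph (ℝ × ℝ) M, IsLocalParam φ → ∀ B : Set E3,
      MeasurableSet B → B ⊆ embed φ '' φ.source → P B)
    (union : ∀ A B : Set E3, MeasurableSet A → MeasurableSet B → A ⊆ M → B ⊆ M → Disjoint A B →
      P A → P B → P (A ∪ B))
    {B : Set E3} (hB : MeasurableSet B) (hBM : B ⊆ M) : P B := by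
  have hsub : ∀ φ : OpenPartialHomeomorph (ℝ × ℝ) M, embed φ '' φ.source ⊆ M := by
    rintro φ _ ⟨x, -, rfl⟩
    exact (φ x).2
  choose φ hφ hpt using hM.exists_param
  choose O hO hOeq using fun p => exists_isOpen_image_embed (φ p)
  obtain ⟨t, ht⟩ := hM.isCompact.elim_finite_subcover O hO fun q hq => by
    refine Set.mem_iUnion.2 ⟨⟨q, hq⟩, ?_⟩
    have : q ∈ M ∩ O ⟨q, hq⟩ := by
      rw [← hOeq]
      exact ⟨(φ ⟨q, hq⟩).symm ⟨q, hq⟩, (φ _).map_target (hpt _),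
        congrArg Subtype.val ((φ _).right_inv (hpt _))⟩
    exact this.2
  have key : ∀ t : Finset M, ∀ B : Set E3, MeasurableSet B → B ⊆ M → B ⊆ ⋃ i ∈ t, O i → P B := by
    classical
    intro t
    induction t using Finset.induction_on with
    | empty =>
      intro B hB hBM hBt
      obtain ⟨p, hp⟩ := hM.nonempty
      refine small _ (hφ ⟨p, hp⟩) B hB fun q hq => ?_
      simpa using hBt hq
    | insert i t _ ih =>
      intro B hB hBM hBt
      have h1 : P (B ∩ O i) := small _ (hφ i) _ (hB.inter (hO i).measurableSet) (by
        rw [hOeq]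
        exact Set.inter_subset_inter_left _ hBM)
      have h2 : P (B \ O i) := by
        refine ih _ (hB.diff (hO i).measurableSet) (Set.sdiff_subset.trans hBM) fun q hq => ?_
        have := hBt hq.1
        rw [Finset.set_biUnion_insert] at this
        exact this.resolve_left hq.2
      rw [← Set.inter_union_sdiff B (O i)]
      exact union _ _ (hB.inter (hO i).measurableSet) (hB.diff (hO i).measurableSet)
        (Set.inter_subset_left.trans hBM) (Set.sdiff_subset.trans hBM)
        Set.disjoint_sdiff_inter.symm h1 h2
  exact key t B hB hBM (hBM.trans ht)

/-- A continuous function that vanishes almost everywhere on the surface vanishes on it. -/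
theorem IsBirkhoffGaussMap.eq_zero_of_ae (hη : IsBirkhoffGaussMap N M η) (hN : IsMinkowskiNorm N)
    (hM : IsClosedSurface M) {f : E3 → ℝ} (hf : ContinuousOn f M)
    (h : ∀ᵐ p ∂(areaMeasure M η), p ∈ M → f p = 0) {p : E3} (hp : p ∈ M) : f p = 0 := by
  by_contra hne
  obtain ⟨φ, hφ, hpt⟩ := hM.exists_param ⟨p, hp⟩
  have hx := φ.map_target hpt
  have hpe : embed φ (φ.symm ⟨p, hp⟩) = p := congrArg Subtype.val (φ.right_inv hpt)
  have h1 : ∀ᵐ q ∂(patchMeasure η φ), q ∈ M → f q = 0 :=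
    (Measure.absolutelyContinuous_of_le hφ.patchMeasure_le).ae_le h
  rw [patchMeasure_eq] at h1
  have h2 := ae_of_ae_map hφ.measurable_measurableEmbed.aemeasurable h1
  rw [ae_withDensity_iff' ((hφ.continuousOn_areaDensity hη.continuousOn).aemeasurable
    φ.open_source.measurableSet), ae_restrict_iff' φ.open_source.measurableSet] at h2
  have hU : IsOpen (φ.source ∩ (fun y => f (embed φ y)) ⁻¹' {0}ᶜ) :=
    (hf.comp hφ.smooth.continuousOn mapsTo_embed).isOpen_inter_preimage φ.open_source
      isOpen_compl_singleton
  -- The density is positive on the source, so the exceptional set is Lebesgue-null in the chart,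
  -- whereas a nonempty open set is not.
  have hpos := hU.measure_pos volume ⟨_, hx, by simpa [hpe] using hne⟩
  refine hpos.ne' (measure_mono_null (fun y hy => ?_) h2)
  simp only [Set.mem_compl_iff, Set.mem_ofPred_eq]
  intro hall
  have h3 := hall hy.1 (by
    simpa [areaDensity] using hη.det3_ne_zero hN hφ hy.1)
  rw [measurableEmbed_of_mem hy.1] at h3
  exact hy.2 (h3 (φ y).2)

/-- The cone over the image of the Birkhoff-Gauss map is controlled by the total curvature. -/
theorem IsBirkhoffGaussMap.volume_coneOver_le (hη : IsBirkhoffGaussMap N M η)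
    (hN : IsMinkowskiNorm N) (hM : IsClosedSurface M) {B : Set E3} (hB : MeasurableSet B)
    (hBM : B ⊆ M) :
    volume (coneOver (η '' B)) ≤ ENNReal.ofReal (1 / 3) *
      ∫⁻ p in B, ENNReal.ofReal |gaussianCurvature M η p| ∂(areaMeasure M η) := by
  refine hM.induction_on (P := fun B => volume (coneOver (η '' B)) ≤ ENNReal.ofReal (1 / 3) *
      ∫⁻ p in B, ENNReal.ofReal |gaussianCurvature M η p| ∂(areaMeasure M η)) (fun φ hφ B hB hBφ => ?_)
    (fun A B hA hB hAM hBM hAB h1 h2 => ?_) hB hBM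
  · set A := φ.source ∩ embed φ ⁻¹' B
    have hBA : η '' B = (fun y => η (embed φ y)) '' A := by
      rw [← Set.image_image η (embed φ), Set.image_inter_preimage, Set.inter_eq_right.2 hBφ]
    have hBM : B ⊆ M := by
      intro q hq
      obtain ⟨x, -, rfl⟩ := hBφ hq
      exact (φ x).2
    have hF : ContinuousOn (fun p => ENNReal.ofReal |gaussianCurvature M η p|) M :=
      ENNReal.continuous_ofReal.comp_continuousOn
        (hη.continuousOn_gaussianCurvature hN hM).abs
    rw [hBA]
    refine (MinkowskiGeometry.volume_coneOver_le φ.open_source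
      (fun x hx => (hη.contDiffAt hN hφ hx).contDiffWithinAt) Set.inter_subset_left
      (hφ.measurableSet_inter hB)).trans ?_
    gcongr
    calc _ = ∫⁻ x in A, areaDensity η φ x
          * ENNReal.ofReal |gaussianCurvature M η (embed φ x)| := by
          refine setLIntegral_congr_fun (hφ.measurableSet_inter hB) fun x hx => ?_
          simp only [hη.det3_fderiv hN hφ hx.1, abs_mul, areaDensity]
          rw [mul_comm, ENNReal.ofReal_mul (abs_nonneg _)]
      _ = ∫⁻ p in B, ENNReal.ofReal |gaussianCurvature M η p| ∂(patchMeasure η φ) :=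
          (hφ.setLIntegral_patchMeasure hη.continuousOn hM.measurableSet hF hB hBM).symm
      _ ≤ _ := lintegral_mono' (Measure.restrict_mono le_rfl hφ.patchMeasure_le) le_rfl
  · rw [Set.image_union, coneOver_union, lintegral_union hB hAB, mul_add]
    exact (measure_union_le _ _).trans (add_le_add h1 h2)

end Compatibility

/-! ### Extremal points of the conormal, and the lower bound -/

section Extrema

variable {N : Seminorm ℝ E3} {M D O : Set E3} {η : E3 → E3}
  {φ : OpenPartialHomeomorph (ℝ × ℝ) M} {x : ℝ × ℝ}

/-- A functional vanishing on the tangent plane is a multiple of the conormal. -/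
theorem IsBirkhoffGaussMap.eq_smul_fderiv (hη : IsBirkhoffGaussMap N M η)
    (hN : IsMinkowskiNorm N) (hφ : IsLocalParam φ) (hx : x ∈ φ.source) {l : E3 →L[ℝ] ℝ}
    (hl : ∀ w, l (fderiv ℝ (embed φ) x w) = 0) (v : E3) :
    l v = l (η (embed φ x)) * fderiv ℝ N (η (embed φ x)) v := by
  obtain ⟨a, b, c, h⟩ := exists_coeffs_of_det3_ne_zero (hη.det3_ne_zero hN hφ hx) v
  rw [h]
  simp [hl, hη.fderiv_embed hN hφ hx, hη.fderiv_self hN (φ x).2, mul_comm]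

theorem eventually_embed_mem (hO : IsOpen O) (hD : D = M ∩ O) (hx : x ∈ φ.source)
    (hxD : embed φ x ∈ D) : ∀ᶠ y in 𝓝 x, embed φ y ∈ D := by
  rw [hD] at hxD ⊢
  have h1 : ∀ᶠ q in 𝓝[M] (embed φ x), q ∈ M ∩ O := by
    filter_upwards [self_mem_nhdsWithin, mem_nhdsWithin_of_mem_nhds (hO.mem_nhds hxD.2)]
      with q h1 h2 using ⟨h1, h2⟩
  rwa [← map_embed_nhds hx, eventually_map] at h1

theorem IsLocalParam.apply_fderiv_eq_zero (hφ : IsLocalParam φ) (hx : x ∈ φ.source)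
    {l : E3 →L[ℝ] ℝ} (h : IsLocalExtr (fun y => l (embed φ y)) x) (w : ℝ × ℝ) :
    l (fderiv ℝ (embed φ) x w) = 0 := by
  have h1 := h.hasFDerivAt_eq_zero
    (l.hasFDerivAt.comp x (hφ.differentiableAt hx).hasFDerivAt)
  exact congrArg (fun L => L w) h1

/-- If the differential of the norm at a unit vector `v` vanishes on the tangent plane, then the
Birkhoff normal is `v` or `-v`. -/
theorem IsBirkhoffGaussMap.eq_or_eq_neg (hη : IsBirkhoffGaussMap N M η)
    (hN : IsMinkowskiNorm N) (hφ : IsLocalParam φ) (hx : x ∈ φ.source) {v : E3} (hv : N v = 1)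
    (hl : ∀ w, fderiv ℝ N v (fderiv ℝ (embed φ) x w) = 0) :
    (η (embed φ x) = v) ∨
      (η (embed φ x) = -v ∧ fderiv ℝ N v = -fderiv ℝ N (η (embed φ x))) := by
  set e := η (embed φ x)
  have hv0 := ne_zero_of_seminorm_eq_one hv
  have he1 : N e = 1 := hη.norm_eq_one _ (φ x).2
  have he0 := hη.ne_zero (φ x).2
  have key := hη.eq_smul_fderiv hN hφ hx hl
  -- Both factors lie in `[-1, 1]`, so they are both `1` or both `-1`; the equality case of the
  -- support inequality then identifies the vectors.
  have h1 : fderiv ℝ N v e * fderiv ℝ N e v = 1 := by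
    rw [← key v, hN.fderiv_self hv0, hv]
  have ha := hN.fderiv_le hv0 e
  have hb := hN.fderiv_le hv0 (-e)
  have hc := hN.fderiv_le he0 v
  have hd := hN.fderiv_le he0 (-v)
  simp only [map_neg, map_neg_eq_map, he1, hv] at ha hb hc hd
  rcases le_or_gt 0 (fderiv ℝ N v e) with h0 | h0
  · left
    have : fderiv ℝ N v e = 1 := by nlinarith
    exact (hN.eq_of_fderiv_eq_one hv he1 this).symm
  · right
    have : fderiv ℝ N v e = -1 := by nlinarith
    refine ⟨?_, ?_⟩
    · have h2 := hN.eq_of_fderiv_eq_one hv (w := -e) (by simpa using he1)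
        (by rw [map_neg, this, neg_neg])
      rw [h2, neg_neg]
    · refine ContinuousLinearMap.ext fun w => ?_
      rw [key w, this, neg_apply, neg_one_mul]

/-- The points of `D` at which the functional `σ • D N (η p)` attains its maximum over `D`. -/
def extremalSet (N : Seminorm ℝ E3) (η : E3 → E3) (D : Set E3) (σ : ℝ) : Set E3 :=
  {p ∈ D | ∀ q ∈ D, σ * fderiv ℝ N (η p) (q - p) ≤ 0}

theorem IsBirkhoffGaussMap.measurableSet_extremalSet (hη : IsBirkhoffGaussMap N M η)
    (hN : IsMinkowskiNorm N) (hDM : D ⊆ M) (hDc : IsCompact D) (hD0 : D.Nonempty) (σ : ℝ) :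
    MeasurableSet (extremalSet N η D σ) := by
  have heq : extremalSet N η D σ
      = ⋂ q ∈ D, D ∩ (fun p => σ * fderiv ℝ N (η p) (q - p)) ⁻¹' Set.Iic 0 := by
    ext p
    simp only [extremalSet, Set.mem_ofPred_eq, Set.mem_iInter, Set.mem_inter_iff,
      Set.mem_preimage, Set.mem_Iic]
    constructor
    · exact fun h q hq => ⟨h.1, h.2 q hq⟩
    · intro h
      obtain ⟨q, hq⟩ := hD0
      exact ⟨(h q hq).1, fun q hq => (h q hq).2⟩
  rw [heq]
  refine (isClosed_biInter fun q _ => ?_).measurableSet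
  refine ContinuousOn.preimage_isClosed_of_isClosed ?_ hDc.isClosed isClosed_Iic
  have h1 : ContinuousOn (fderiv ℝ N) {0}ᶜ :=
    hN.smooth.continuousOn_fderiv_of_isOpen isOpen_compl_singleton (by simp)
  have h2 : ContinuousOn (fun p => fderiv ℝ N (η p)) D :=
    h1.comp (hη.continuousOn.mono hDM) fun p hp => hη.ne_zero (hDM hp)
  exact continuousOn_const.mul (h2.clm_apply (continuousOn_const.sub continuousOn_id))

theorem IsBirkhoffGaussMap.gaussianCurvature_nonneg_of_mem_extremalSet
    (hη : IsBirkhoffGaussMap N M η) (hN : IsMinkowskiNorm N) (hM : IsClosedSurface M)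
    (hO : IsOpen O) (hD : D = M ∩ O) {σ : ℝ} (hσ : σ = 1 ∨ σ = -1) {p : E3}
    (hp : p ∈ extremalSet N η D σ) : 0 ≤ gaussianCurvature M η p := by
  have hpM : p ∈ M := (hD.le hp.1).1
  obtain ⟨φ, hφ, hpt⟩ := hM.exists_param ⟨p, hpM⟩
  have hx := φ.map_target hpt
  have hpe : embed φ (φ.symm ⟨p, hpM⟩) = p := congrArg Subtype.val (φ.right_inv hpt)
  set x := φ.symm ⟨p, hpM⟩
  have hev := eventually_embed_mem hO hD hx (by rw [hpe]; exact hp.1)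
  rw [← hpe]
  refine hη.gaussianCurvature_nonneg hN hφ hx ?_
  rcases hσ with rfl | rfl
  · right
    filter_upwards [hev] with y hy
    have := hp.2 _ hy
    rw [map_sub] at this
    rw [hpe]
    linarith
  · left
    filter_upwards [hev] with y hy
    have := hp.2 _ hy
    rw [map_sub] at this
    rw [hpe]
    linarith

/-- At a maximum point of a functional, the functional kills the tangent plane. -/
theorem IsClosedSurface.exists_isMax (hM : IsClosedSurface M) (hO : IsOpen O) (hD : D = M ∩ O)
    (hDc : IsCompact D) (hD0 : D.Nonempty) (l : E3 →L[ℝ] ℝ) :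
    ∃ (φ : OpenPartialHomeomorph (ℝ × ℝ) M) (x : ℝ × ℝ), IsLocalParam φ ∧ x ∈ φ.source ∧
      embed φ x ∈ D ∧ (∀ q ∈ D, l q ≤ l (embed φ x)) ∧
      ∀ w, l (fderiv ℝ (embed φ) x w) = 0 := by
  obtain ⟨p, hpD, hmax⟩ := hDc.exists_isMaxOn hD0 l.continuous.continuousOn
  have hpM : p ∈ M := (hD.le hpD).1
  obtain ⟨φ, hφ, hpt⟩ := hM.exists_param ⟨p, hpM⟩
  have hx := φ.map_target hpt
  have hpe : embed φ (φ.symm ⟨p, hpM⟩) = p := congrArg Subtype.val (φ.right_inv hpt)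
  set x := φ.symm ⟨p, hpM⟩
  rw [← hpe] at hmax hpD
  have hev := eventually_embed_mem hO hD hx hpD
  refine ⟨φ, x, hφ, hx, hpD, fun q hq => hmax hq, hφ.apply_fderiv_eq_zero hx (Or.inr ?_)⟩
  filter_upwards [hev] with y hy using hmax hy

/-- At a common point `p` the conormal is constant on `D`, so `D` lies in a plane parallel to
`T_pM`. Take a nonzero tangent vector `X` at `p` and a maximum point of `dN_X` on `D`. There both
`dN_X` and the conormal of `p` kill the tangent plane, so both are multiples of the conormal at that
point. The second one is nonzero and kills `X`, so `N X = dN_X(X) = 0`, a contradiction. -/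
theorem IsBirkhoffGaussMap.disjoint_extremalSet (hη : IsBirkhoffGaussMap N M η)
    (hN : IsMinkowskiNorm N) (hM : IsClosedSurface M) (hO : IsOpen O) (hD : D = M ∩ O)
    (hDc : IsCompact D) : Disjoint (extremalSet N η D 1) (extremalSet N η D (-1)) := by
  rw [Set.disjoint_left]
  intro p hp1 hp2
  have hpM : p ∈ M := (hD.le hp1.1).1
  have hconst : ∀ q ∈ D, fderiv ℝ N (η p) q = fderiv ℝ N (η p) p := by
    intro q hq
    have h1 := hp1.2 q hq
    have h2 := hp2.2 q hq
    rw [map_sub] at h1 h2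
    linarith
  obtain ⟨φ, hφ, hpt⟩ := hM.exists_param ⟨p, hpM⟩
  have hx := φ.map_target hpt
  have hpe : embed φ (φ.symm ⟨p, hpM⟩) = p := congrArg Subtype.val (φ.right_inv hpt)
  set x := φ.symm ⟨p, hpM⟩
  set X := fderiv ℝ (embed φ) x (1, 0)
  have hX0 : X ≠ 0 := fun h => by
    have := hφ.linearIndependent hx 1 0 (by rw [zero_smul, add_zero, one_smul]; exact h)
    exact one_ne_zero this.1
  have hlX : fderiv ℝ N (η p) X = 0 := by
    have := hη.fderiv_embed hN hφ hx (1, 0)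
    rwa [hpe] at this
  obtain ⟨ψ, y, hψ, hy, hyD, -, hcrit⟩ := hM.exists_isMax hO hD hDc ⟨p, hp1.1⟩ (fderiv ℝ N X)
  have hcrit' : ∀ w, fderiv ℝ N (η p) (fderiv ℝ (embed ψ) y w) = 0 := by
    refine hψ.apply_fderiv_eq_zero hy (Or.inr ?_)
    filter_upwards [eventually_embed_mem hO hD hy hyD] with z hz
    exact ((hconst _ hz).trans (hconst _ hyD).symm).le
  have h1 := hη.eq_smul_fderiv hN hψ hy hcrit X
  have h2 := hη.eq_smul_fderiv hN hψ hy hcrit' X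
  have h3 := hη.eq_smul_fderiv hN hψ hy hcrit' (η p)
  rw [hη.fderiv_self hN hpM] at h3
  rw [hlX] at h2
  have h4 : fderiv ℝ N (η (embed ψ y)) X = 0 := by
    rcases mul_eq_zero.1 h2.symm with h | h
    · rw [h, zero_mul] at h3
      exact absurd h3 one_ne_zero
    · exact h
  rw [h4, mul_zero, hN.fderiv_self hX0] at h1
  exact (hN.pos hX0).ne' h1

/-- For the unit vector `v` in the direction of `z`, take a maximum point of `dN_v` on `D`, where `η
= ±v`. The sign decides whether the conormal of that point is maximal or minimal there. -/
theorem IsBirkhoffGaussMap.ball_subset_coneOver (hη : IsBirkhoffGaussMap N M η)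
    (hN : IsMinkowskiNorm N) (hM : IsClosedSurface M) (hO : IsOpen O) (hD : D = M ∩ O)
    (hDc : IsCompact D) (hD0 : D.Nonempty) :
    {z | N z < 1} ⊆ {0} ∪ (coneOver (η '' extremalSet N η D 1) ∪
      -coneOver (η '' extremalSet N η D (-1))) := by
  intro z hz
  have hz : N z < 1 := hz
  rcases eq_or_ne z 0 with h0 | h0
  · exact Or.inl h0
  right
  have hNz := hN.pos h0
  set v := (N z)⁻¹ • z with hv
  have hzv : z = N z • v := by rw [hv, smul_smul, mul_inv_cancel₀ hNz.ne', one_smul]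
  have hv1 : N v = 1 := by
    rw [hv, map_smul_eq_mul, norm_inv, Real.norm_eq_abs, abs_of_pos hNz,
      inv_mul_cancel₀ hNz.ne']
  obtain ⟨φ, x, hφ, hx, hxD, hmax, hcrit⟩ := hM.exists_isMax hO hD hDc hD0 (fderiv ℝ N v)
  rcases hη.eq_or_eq_neg hN hφ hx hv1 hcrit with h | ⟨h, h'⟩
  · left
    refine ⟨v, ⟨embed φ x, ⟨hxD, fun q hq => ?_⟩, h⟩, N z, ⟨hNz, hz⟩, hzv⟩
    rw [h, map_sub]
    linarith [hmax q hq]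
  · right
    refine ⟨-v, ⟨embed φ x, ⟨hxD, fun q hq => ?_⟩, h⟩, N z, ⟨hNz, hz⟩, ?_⟩
    · have := hmax q hq
      rw [h', neg_apply, neg_apply] at this
      rw [map_sub]
      linarith
    · rw [smul_neg, ← hzv]

/-- The elliptic points of a closed and open part of a closed surface carry total curvature at
least three times the volume of the unit ball. -/
theorem IsBirkhoffGaussMap.exists_elliptic (hη : IsBirkhoffGaussMap N M η)
    (hN : IsMinkowskiNorm N) (hM : IsClosedSurface M) (hO : IsOpen O) (hD : D = M ∩ O)
    (hDc : IsCompact D) (hD0 : D.Nonempty) :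
    ∃ P ⊆ D, MeasurableSet P ∧ (∀ p ∈ P, 0 ≤ gaussianCurvature M η p) ∧
      3 * ballVolume N ≤
        ∫⁻ p in P, ENNReal.ofReal (gaussianCurvature M η p) ∂(areaMeasure M η) := by
  have hDM : D ⊆ M := hD.le.trans Set.inter_subset_left
  set P := extremalSet N η D 1
  set Q := extremalSet N η D (-1)
  have hP : MeasurableSet P := hη.measurableSet_extremalSet hN hDM hDc hD0 1
  have hQ : MeasurableSet Q := hη.measurableSet_extremalSet hN hDM hDc hD0 (-1)
  have hPD : P ⊆ D := fun p hp => hp.1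
  have hQD : Q ⊆ D := fun p hp => hp.1
  have hnn : ∀ p ∈ P ∪ Q, 0 ≤ gaussianCurvature M η p := by
    rintro p (hp | hp)
    · exact hη.gaussianCurvature_nonneg_of_mem_extremalSet hN hM hO hD (Or.inl rfl) hp
    · exact hη.gaussianCurvature_nonneg_of_mem_extremalSet hN hM hO hD (Or.inr rfl) hp
  refine ⟨P ∪ Q, Set.union_subset hPD hQD, hP.union hQ, hnn, ?_⟩
  have h1 : ballVolume N ≤ ENNReal.ofReal (1 / 3) *
      ∫⁻ p in P ∪ Q, ENNReal.ofReal |gaussianCurvature M η p| ∂(areaMeasure M η) := by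
    rw [lintegral_union hQ (hη.disjoint_extremalSet hN hM hO hD hDc), mul_add]
    refine (measure_mono (hη.ball_subset_coneOver hN hM hO hD hDc hD0)).trans ?_
    refine (measure_union_le _ _).trans ?_
    rw [measure_singleton, zero_add]
    refine (measure_union_le _ _).trans (add_le_add ?_ ?_)
    · exact hη.volume_coneOver_le hN hM hP (hPD.trans hDM)
    · rw [Measure.measure_neg]
      exact hη.volume_coneOver_le hN hM hQ (hQD.trans hDM)
  have h2 : ∫⁻ p in P ∪ Q, ENNReal.ofReal |gaussianCurvature M η p| ∂(areaMeasure M η)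
      = ∫⁻ p in P ∪ Q, ENNReal.ofReal (gaussianCurvature M η p) ∂(areaMeasure M η) :=
    setLIntegral_congr_fun (hP.union hQ) fun p hp => by simp only [abs_of_nonneg (hnn p hp)]
  rw [h2] at h1
  calc 3 * ballVolume N ≤ 3 * (ENNReal.ofReal (1 / 3) * _) := by gcongr
    _ = _ := by
      rw [← mul_assoc]
      have : (3 : ℝ≥0∞) * ENNReal.ofReal (1 / 3) = 1 := by
        rw [show (3 : ℝ≥0∞) = ENNReal.ofReal 3 by simp, ← ENNReal.ofReal_mul (by norm_num)]
        norm_num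
      rw [this, one_mul]

theorem IsBirkhoffGaussMap.gaussianCurvature_le_of_mem (hη : IsBirkhoffGaussMap N M η)
    (hN : IsMinkowskiNorm N) (hM : IsClosedSurface M) {p : E3} (hp : p ∈ M) :
    gaussianCurvature M η p ≤ meanCurvature M η p ^ 2 := by
  obtain ⟨φ, hφ, hpt⟩ := hM.exists_param ⟨p, hp⟩
  have hpe : embed φ (φ.symm ⟨p, hp⟩) = p := congrArg Subtype.val (φ.right_inv hpt)
  have := hη.gaussianCurvature_le hN hφ (φ.map_target hpt)
  rwa [hpe] at this

/-- The Willmore inequality on a closed and open part of a closed surface. -/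
theorem IsBirkhoffGaussMap.le_setLIntegral (hη : IsBirkhoffGaussMap N M η)
    (hN : IsMinkowskiNorm N) (hM : IsClosedSurface M) (hO : IsOpen O) (hD : D = M ∩ O)
    (hDc : IsCompact D) (hD0 : D.Nonempty) :
    3 * ballVolume N ≤
      ∫⁻ p in D, ENNReal.ofReal (meanCurvature M η p ^ 2) ∂(areaMeasure M η) := by
  obtain ⟨P, hPD, hP, -, h⟩ := hη.exists_elliptic hN hM hO hD hDc hD0
  refine h.trans (le_trans ?_ (lintegral_mono_set hPD))
  refine setLIntegral_mono_ae' hP (Eventually.of_forall fun p hp => ?_)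
  exact ENNReal.ofReal_le_ofReal
    (hη.gaussianCurvature_le_of_mem hN hM (hD.le (hPD hp)).1)

end Extrema

/-! ### Minkowski spheres: mean curvature and area -/

section Sphere

variable {N : Seminorm ℝ E3} {M : Set E3} {η : E3 → E3}
  {φ : OpenPartialHomeomorph (ℝ × ℝ) M} {x : ℝ × ℝ} {c : E3} {r : ℝ}

theorem fderiv_sub_const_embed (y : ℝ × ℝ) :
    fderiv ℝ (fun y => embed φ y - c) y = fderiv ℝ (embed φ) y :=
  fderiv_sub_const c

theorem seminorm_inv_smul (hr : 0 < r) {z : E3} (hz : N z = r) : N (r⁻¹ • z) = 1 := by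
  rw [map_smul_eq_mul, hz, norm_inv, Real.norm_eq_abs, abs_of_pos hr, inv_mul_cancel₀ hr.ne']

/-- The Birkhoff normals of a Minkowski sphere are radial. -/
theorem IsBirkhoffGaussMap.radial (hη : IsBirkhoffGaussMap N M η)
    (hN : IsMinkowskiNorm N) (hφ : IsLocalParam φ) (hr : 0 < r)
    (hM : ∀ p ∈ M, N (p - c) = r) (hx : x ∈ φ.source) :
    η (embed φ x) = r⁻¹ • (embed φ x - c) ∨ η (embed φ x) = -(r⁻¹ • (embed φ x - c)) := by
  have hv : N (r⁻¹ • (embed φ x - c)) = 1 := seminorm_inv_smul hr (hM _ (φ x).2)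
  have h1 : HasFDerivAt (fun y => r⁻¹ • (embed φ y - c)) (r⁻¹ • fderiv ℝ (embed φ) x) x :=
    ((hφ.differentiableAt hx).hasFDerivAt.sub_const c).const_smul r⁻¹
  have h2 : HasFDerivAt (fun y => N (r⁻¹ • (embed φ y - c))) _ x :=
    (hN.differentiableAt (ne_zero_of_seminorm_eq_one hv)).hasFDerivAt.comp x h1
  have h3 : HasFDerivAt (fun y => N (r⁻¹ • (embed φ y - c))) (0 : ℝ × ℝ →L[ℝ] ℝ) x :=
    (hasFDerivAt_const (1 : ℝ) x).congr_of_eventuallyEq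
      (Eventually.of_forall fun y => seminorm_inv_smul hr (hM _ (φ y).2))
  refine (hη.eq_or_eq_neg hN hφ hx hv fun w => ?_).imp id And.left
  have h4 := congrArg (fun L => L w) (h2.unique h3)
  simp only [ContinuousLinearMap.comp_apply, smul_apply, map_smul, smul_eq_mul,
    zero_apply] at h4
  exact (mul_eq_zero.1 h4).resolve_left (inv_ne_zero hr.ne')

theorem IsBirkhoffGaussMap.meanCurvature_sq_of_sphere (hη : IsBirkhoffGaussMap N M η)
    (hN : IsMinkowskiNorm N) (hφ : IsLocalParam φ) (hr : 0 < r)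
    (hM : ∀ p ∈ M, N (p - c) = r) (hx : x ∈ φ.source) :
    meanCurvature M η (embed φ x) ^ 2 = (r⁻¹) ^ 2 := by
  set v : ℝ × ℝ → E3 := fun y => r⁻¹ • (embed φ y - c) with hv
  have hv1 : N (v x) = 1 := seminorm_inv_smul hr (hM _ (φ x).2)
  have hv0 := ne_zero_of_seminorm_eq_one hv1
  have hvc : ContinuousAt v x :=
    ((hφ.differentiableAt hx).continuousAt.sub continuousAt_const).const_smul r⁻¹
  set l := fderiv ℝ N (v x)
  have hl : l (v x) = 1 := by rw [hN.fderiv_self hv0, hv1]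
  have hlv : ∀ᶠ y in 𝓝 x, 0 < l (v y) :=
    (l.continuous.continuousAt.comp hvc).eventually_const_lt (by simp [hl])
  have hlη : ContinuousAt (fun y => l (η (embed φ y))) x :=
    l.continuous.continuousAt.comp (hη.continuousAt hx)
  -- The sign of `η` relative to the radial field is locally constant by continuity, as detected by
  -- `l`, and it disappears from `H²`.
  have hsgn : ∃ s : ℝ, s ^ 2 = 1 ∧ ∀ᶠ y in 𝓝 x, η (embed φ y) = s • v y := by
    rcases hη.radial hN hφ hr hM hx with h | h
    · refine ⟨1, by norm_num, ?_⟩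
      have : ∀ᶠ y in 𝓝 x, 0 < l (η (embed φ y)) := hlη.eventually_const_lt (by
        change 0 < l (η (embed φ x))
        rw [h]
        exact one_pos.trans_eq hl.symm)
      filter_upwards [hlv, this, φ.open_source.mem_nhds hx] with y h1 h2 hy
      rcases hη.radial hN hφ hr hM hy with h3 | h3
      · rw [h3, one_smul]
      · rw [h3, map_neg] at h2
        exact absurd h1 (by linarith)
    · refine ⟨-1, by norm_num, ?_⟩
      have : ∀ᶠ y in 𝓝 x, l (η (embed φ y)) < 0 := hlη.eventually_lt_const (by
        change l (η (embed φ x)) < 0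
        rw [h, map_neg]
        exact neg_lt_zero.2 (one_pos.trans_eq hl.symm))
      filter_upwards [hlv, this, φ.open_source.mem_nhds hx] with y h1 h2 hy
      rcases hη.radial hN hφ hr hM hy with h3 | h3
      · rw [h3] at h2
        exact absurd h1 (not_lt.2 h2.le)
      · rw [h3, neg_one_smul]
  obtain ⟨s, hs, hev⟩ := hsgn
  have h1 : HasFDerivAt (fun y => η (embed φ y)) (s • r⁻¹ • fderiv ℝ (embed φ) x) x :=
    ((((hφ.differentiableAt hx).hasFDerivAt.sub_const c).const_smul r⁻¹).const_smul
      s).congr_of_eventuallyEq hev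
  have h2 := hφ.meanCurvature_eq hx h1.differentiableAt (a := s * r⁻¹) (b := 0) (c := 0)
    (d := s * r⁻¹) (by rw [h1.fderiv]; simp [smul_smul]) (by rw [h1.fderiv]; simp [smul_smul])
  rw [h2]
  have : (s * r⁻¹ + s * r⁻¹) / 2 = s * r⁻¹ := by ring
  rw [this, mul_pow, hs, one_mul]

theorem IsBirkhoffGaussMap.areaDensity_of_sphere (hη : IsBirkhoffGaussMap N M η)
    (hN : IsMinkowskiNorm N) (hφ : IsLocalParam φ) (hr : 0 < r)
    (hM : ∀ p ∈ M, N (p - c) = r) (hx : x ∈ φ.source) :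
    areaDensity η φ x = ENNReal.ofReal r⁻¹ * ENNReal.ofReal |det3
      (fderiv ℝ (fun y => embed φ y - c) x (1, 0)) (fderiv ℝ (fun y => embed φ y - c) x (0, 1))
      (embed φ x - c)| := by
  rw [fderiv_sub_const_embed, ← ENNReal.ofReal_mul (by positivity), areaDensity]
  congr 1
  rw [← abs_of_pos (inv_pos.2 hr), ← abs_mul, ← det3_smul_left]
  rcases hη.radial hN hφ hr hM hx with h | h
  · rw [h]
  · rw [h, ← abs_neg]
    congr 1
    rw [← neg_one_smul ℝ (r⁻¹ • (embed φ x - c)), det3_smul_left]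
    ring

open scoped Pointwise in
theorem volume_lt_eq (N : Seminorm ℝ E3) (hr : 0 < r) :
    volume {z | N z < r} = ENNReal.ofReal (r ^ 3) * ballVolume N := by
  have h1 : {z | N z < r} = r • {z | N z < 1} := by
    ext z
    rw [Set.mem_smul_set_iff_inv_smul_mem₀ hr.ne']
    simp only [Set.mem_ofPred_eq, map_smul_eq_mul, norm_inv, Real.norm_eq_abs, abs_of_pos hr]
    rw [inv_mul_lt_iff₀ hr, mul_one]
  rw [h1, Measure.addHaar_smul, ballVolume, finrank_euclideanSpace_fin,
    abs_of_pos (by positivity)]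

/-- The area of a Minkowski sphere is at most `3 r²` times the volume of the unit ball. -/
theorem IsBirkhoffGaussMap.areaMeasure_le_of_sphere (hη : IsBirkhoffGaussMap N M η)
    (hN : IsMinkowskiNorm N) (hr : 0 < r) (hM : ∀ p ∈ M, N (p - c) = r) :
    areaMeasure M η Set.univ ≤ ENNReal.ofReal (r ^ 2) * (3 * ballVolume N) := by
  -- Radial projection of the ball of radius `r` about 0 onto the sphere about `c`. By the cone
  -- formula, the image of Lebesgue measure under `ρ`, multiplied by `3 / r`, dominates every patch
  -- measure.
  set ρ : E3 → E3 := fun z => c + (r / N z) • z with hρ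
  have hρm : Measurable ρ :=
    ((measurable_const.div (continuous_seminorm N).measurable).smul measurable_id).const_add c
  have hB : MeasurableSet {z | N z < r} :=
    (isOpen_lt (continuous_seminorm N) continuous_const).measurableSet
  have h3 : (3 : ℝ≥0∞) = ENNReal.ofReal 3 := by simp
  have hle : areaMeasure M η ≤ ENNReal.ofReal (3 / r) •
      (volume.restrict {z | N z < r}).map ρ := by
    refine areaMeasure_le fun φ hφ => Measure.le_iff.2 fun s hs => ?_
    rw [hφ.patchMeasure_apply hs, Measure.smul_apply, Measure.map_apply hρm hs,
      Measure.restrict_apply (hρm hs), smul_eq_mul]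
    set A := φ.source ∩ embed φ ⁻¹' s
    have hA : MeasurableSet A := hφ.measurableSet_inter hs
    set g : ℝ × ℝ → E3 := fun y => embed φ y - c with hg
    have hgN : ∀ y, N (g y) = r := fun y => hM _ (φ y).2
    have hsmul : ∀ y, ∀ t ∈ Set.Ioo (0 : ℝ) 1, N (t • g y) = t * r := fun y t ht => by
      rw [map_smul_eq_mul, hgN, Real.norm_eq_abs, abs_of_pos ht.1]
    have hinj : Set.InjOn (fun z : (ℝ × ℝ) × ℝ => z.2 • g z.1) (A ×ˢ Set.Ioo 0 1) := by
      rintro ⟨y, t⟩ ⟨hy, ht⟩ ⟨y', t'⟩ ⟨hy', ht'⟩ h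
      simp only at hy ht hy' ht' h
      have htt : t = t' := by
        have := congrArg N h
        rw [hsmul y t ht, hsmul y' t' ht'] at this
        exact mul_right_cancel₀ hr.ne' this
      subst htt
      have hgg : g y = g y' := smul_right_injective E3 ht.1.ne' h
      rw [embed_injOn hy.1 hy'.1 (sub_left_injective hgg)]
    have hvol := volume_coneOver_eq φ.open_source (hφ.smooth.sub contDiffOn_const)
      Set.inter_subset_left hA hinj
    have hsub : coneOver (g '' A) ⊆ ρ ⁻¹' s ∩ {z | N z < r} := by
      rintro _ ⟨_, ⟨y, hy, rfl⟩, t, ht, rfl⟩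
      constructor
      · have : ρ (t • g y) = embed φ y := by
          simp only [hρ, hsmul y t ht, smul_smul]
          have : r / (t * r) * t = 1 := by
            have := ht.1.ne'
            field_simp
          rw [this, one_smul, hg]
          simp
        rw [Set.mem_preimage, this]
        exact hy.2
      · change N (t • g y) < r
        rw [hsmul y t ht]
        exact mul_lt_of_lt_one_left hr ht.2
    calc ∫⁻ y in A, areaDensity η φ y
        = ∫⁻ y in A, ENNReal.ofReal r⁻¹ *
            ENNReal.ofReal |det3 (fderiv ℝ g y (1, 0)) (fderiv ℝ g y (0, 1)) (g y)| :=
          setLIntegral_congr_fun hA fun y hy => hη.areaDensity_of_sphere hN hφ hr hM hy.1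
      _ = ENNReal.ofReal (3 / r) * volume (coneOver (g '' A)) := by
          rw [hvol, lintegral_const_mul' _ _ ENNReal.ofReal_ne_top, ← mul_assoc,
            ← ENNReal.ofReal_mul (by positivity)]
          congr 2
          field_simp
      _ ≤ _ := by gcongr
  refine (hle Set.univ).trans_eq ?_
  rw [Measure.smul_apply, Measure.map_apply hρm MeasurableSet.univ, Set.preimage_univ,
    Measure.restrict_apply_univ, volume_lt_eq N hr, smul_eq_mul, ← mul_assoc, ← mul_assoc, h3,
    ← ENNReal.ofReal_mul (by positivity), ← ENNReal.ofReal_mul (by positivity)]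
  congr 2
  field_simp

theorem lintegral_eq_setLIntegral (hM : MeasurableSet M) (F : E3 → ℝ≥0∞) :
    ∫⁻ p, F p ∂(areaMeasure M η) = ∫⁻ p in M, F p ∂(areaMeasure M η) := by
  rw [areaMeasure_restrict hM]

theorem IsBirkhoffGaussMap.lintegral_of_sphere (hη : IsBirkhoffGaussMap N M η)
    (hN : IsMinkowskiNorm N) (hS : IsClosedSurface M) (hr : 0 < r)
    (hM : ∀ p ∈ M, N (p - c) = r) :
    ∫⁻ p, ENNReal.ofReal (meanCurvature M η p ^ 2) ∂(areaMeasure M η)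
      = ENNReal.ofReal ((r⁻¹) ^ 2) * areaMeasure M η Set.univ := by
  have h1 : areaMeasure M η Set.univ = areaMeasure M η M := by
    rw [← Measure.restrict_apply_univ M, areaMeasure_restrict hS.measurableSet]
  rw [lintegral_eq_setLIntegral hS.measurableSet, h1, ← setLIntegral_const]
  refine setLIntegral_congr_fun hS.measurableSet fun p hp => ?_
  obtain ⟨φ, hφ, hpt⟩ := hS.exists_param ⟨p, hp⟩
  have hpe : embed φ (φ.symm ⟨p, hp⟩) = p := congrArg Subtype.val (φ.right_inv hpt)
  have := hη.meanCurvature_sq_of_sphere hN hφ hr hM (φ.map_target hpt)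
  rw [hpe] at this
  simp only [this]

theorem IsBirkhoffGaussMap.le_lintegral (hη : IsBirkhoffGaussMap N M η)
    (hN : IsMinkowskiNorm N) (hM : IsClosedSurface M) :
    3 * ballVolume N ≤
      ∫⁻ p, ENNReal.ofReal (meanCurvature M η p ^ 2) ∂(areaMeasure M η) := by
  rw [lintegral_eq_setLIntegral hM.measurableSet]
  exact hη.le_setLIntegral hN hM isOpen_univ (Set.inter_univ M).symm hM.isCompact hM.nonempty

/-- The area bound gives one inequality and the general lower bound gives the other, so the area of
the sphere need not be known exactly beforehand. -/
theorem IsBirkhoffGaussMap.lintegral_eq_of_sphere (hη : IsBirkhoffGaussMap N M η)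
    (hN : IsMinkowskiNorm N) (hS : IsClosedSurface M) (hr : 0 < r)
    (hM : ∀ p ∈ M, N (p - c) = r) :
    ∫⁻ p, ENNReal.ofReal (meanCurvature M η p ^ 2) ∂(areaMeasure M η) = 3 * ballVolume N := by
  refine le_antisymm ?_ (hη.le_lintegral hN hS)
  rw [hη.lintegral_of_sphere hN hS hr hM]
  calc _ ≤ ENNReal.ofReal ((r⁻¹) ^ 2) * (ENNReal.ofReal (r ^ 2) * (3 * ballVolume N)) := by
        gcongr
        exact hη.areaMeasure_le_of_sphere hN hr hM
    _ = 3 * ballVolume N := by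
        rw [← mul_assoc, ← ENNReal.ofReal_mul (by positivity)]
        have : (r⁻¹) ^ 2 * r ^ 2 = 1 := by field_simp
        rw [this, ENNReal.ofReal_one, one_mul]

/-- This bound needs no parametrizations covering the unit sphere, because its area is defined as a
supremum over those that exist. -/
theorem IsMinkowskiNorm.unitSphereArea_le (hN : IsMinkowskiNorm N) :
    unitSphereArea N ≤ 3 * ballVolume N := by
  have := (isBirkhoffGaussMap_id hN).areaMeasure_le_of_sphere hN (c := 0) one_pos
    fun p hp => by rw [sub_zero]; exact hp
  simpa [unitSphereArea] using this

theorem IsMinkowskiNorm.unitSphereArea_eq (hN : IsMinkowskiNorm N)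
    (hS : IsClosedSurface (unitSphere N)) : unitSphereArea N = 3 * ballVolume N := by
  have hM : ∀ p ∈ unitSphere N, N (p - 0) = 1 := fun p hp => by rw [sub_zero]; exact hp
  have h1 := (isBirkhoffGaussMap_id hN).lintegral_of_sphere hN hS one_pos hM
  rw [(isBirkhoffGaussMap_id hN).lintegral_eq_of_sphere hN hS one_pos hM] at h1
  simpa [unitSphereArea] using h1.symm

/-- A homothety between a Minkowski sphere and the unit sphere. -/
def sphereHomeomorph (N : Seminorm ℝ E3) (c : E3) (hr : 0 < r) :
    {x | N (x - c) = r} ≃ₜ unitSphere N where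
  toFun p := ⟨r⁻¹ • (p.1 - c), seminorm_inv_smul hr p.2⟩
  invFun q := ⟨c + r • q.1, by
    have hq : N q.1 = 1 := q.2
    rw [Set.mem_ofPred_eq, add_sub_cancel_left, map_smul_eq_mul, hq, Real.norm_eq_abs,
      abs_of_pos hr, mul_one]⟩
  left_inv p := by
    ext1
    simp [smul_smul, hr.ne']
  right_inv q := by
    ext1
    simp [smul_smul, hr.ne']
  continuous_toFun := by fun_prop
  continuous_invFun := by fun_prop

/-- Parametrizations of a Minkowski sphere are carried to the unit sphere by the homothety, so none
have to be constructed from the level set of `N`. -/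
theorem IsClosedSurface.unitSphere_of_sphere (hr : 0 < r)
    (hS : IsClosedSurface {x | N (x - c) = r}) : IsClosedSurface (unitSphere N) := by
  set e := sphereHomeomorph N c hr
  refine ⟨?_, ?_, fun q => ?_⟩
  · obtain ⟨p, hp⟩ := hS.nonempty
    exact ⟨_, (e ⟨p, hp⟩).2⟩
  · have := isCompact_iff_compactSpace.1 hS.isCompact
    exact isCompact_iff_compactSpace.2 e.compactSpace
  · obtain ⟨φ, hφ, hpt⟩ := hS.exists_param (e.symm q)
    have hemb : ∀ y, ((φ.transHomeomorph e y : unitSphere N) : E3) = r⁻¹ • (embed φ y - c) :=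
      fun _ => rfl
    refine ⟨φ.transHomeomorph e, ⟨?_, fun y hy => ?_⟩, hpt⟩
    · exact (hφ.smooth.sub contDiffOn_const).const_smul r⁻¹
    · have hy : y ∈ φ.source := hy
      have h1 : HasFDerivAt (fun y => ((φ.transHomeomorph e y : unitSphere N) : E3))
          (r⁻¹ • fderiv ℝ (embed φ) y) y :=
        ((hφ.differentiableAt hy).hasFDerivAt.sub_const c).const_smul r⁻¹
      rw [h1.fderiv]
      exact (smul_right_injective E3 (inv_ne_zero hr.ne')).comp (hφ.regular y hy)

end Sphere

/-! ### The equality case -/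

section Rigidity

variable {N : Seminorm ℝ E3} {M : Set E3} {η : E3 → E3} {c : E3} {r : ℝ}

/-- The sphere is the image of the connected set `ℝ³ ∖ {0}` under radial projection. -/
theorem isPreconnected_sphere (hN : IsMinkowskiNorm N) (c : E3) (hr : 0 < r) :
    IsPreconnected {x | N (x - c) = r} := by
  have h1 : IsPreconnected ({0}ᶜ : Set E3) :=
    (isConnected_compl_singleton_of_one_lt_rank (by
      rw [← Module.finrank_eq_rank, finrank_euclideanSpace_fin]
      norm_num) 0).isPreconnected
  have h2 : ContinuousOn (fun x : E3 => c + (r / N x) • x) {0}ᶜ :=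
    continuousOn_const.add ((continuousOn_const.div (continuous_seminorm N).continuousOn
      fun x hx => (hN.pos hx).ne').smul continuousOn_id)
  convert h1.image _ h2 using 1
  ext x
  constructor
  · intro hx
    have hx : N (x - c) = r := hx
    refine ⟨x - c, ?_, ?_⟩
    · rintro h
      have h : x - c = 0 := h
      rw [h, map_zero] at hx
      exact hr.ne hx
    · simp only [hx, div_self hr.ne', one_smul, add_sub_cancel]
  · rintro ⟨y, hy, rfl⟩
    have hp := hN.pos hy
    rw [Set.mem_ofPred_eq, add_sub_cancel_left, map_smul_eq_mul, Real.norm_eq_abs,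
      abs_of_pos (by positivity), div_mul_cancel₀ _ hp.ne']

/-- A closed surface contained in a Minkowski sphere is the whole sphere. -/
theorem IsClosedSurface.eq_sphere (hN : IsMinkowskiNorm N) (hM : IsClosedSurface M)
    (hη : IsBirkhoffGaussMap N M η) (hr : 0 < r) (hsub : ∀ p ∈ M, N (p - c) = r) :
    M = {x | N (x - c) = r} := by
  refine Set.Subset.antisymm hsub ?_
  have hopen : ∀ p ∈ M, ∀ᶠ q in 𝓝 p, N (q - c) = r → q ∈ M := by
    intro p hp
    obtain ⟨φ, hφ, hpt⟩ := hM.exists_param ⟨p, hp⟩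
    have hx := φ.map_target hpt
    have hpe : embed φ (φ.symm ⟨p, hp⟩) = p := congrArg Subtype.val (φ.right_inv hpt)
    set x := φ.symm ⟨p, hp⟩
    set g : ℝ × ℝ → E3 := fun y => embed φ y - c with hg
    -- The cone map is open at `(x, 1)`, so every `q` near `p` satisfies `q - c = t • (p' - c)` with
    -- `p' ∈ M` and `t > 0`. If `q` is on the sphere, then `t = 1` and `q = p'`.
    set Φ : (ℝ × ℝ) × ℝ → E3 := fun z => z.2 • g z.1 with hΦ
    have hgd : DifferentiableAt ℝ g x := (hφ.differentiableAt hx).sub_const c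
    have hgs : ContDiffAt ℝ ∞ g x := (hφ.contDiffAt hx).sub contDiffAt_const
    have hΦs : ContDiffAt ℝ ∞ Φ (x, 1) :=
      contDiffAt_snd.smul (ContDiffAt.comp (g := g) (f := Prod.fst) (x, (1 : ℝ)) hgs
        contDiffAt_fst)
    have hstrict := hΦs.hasStrictFDerivAt (by simp)
    have hdet : det3 (fderiv ℝ (embed φ) x (1, 0)) (fderiv ℝ (embed φ) x (0, 1)) (g x) ≠ 0 := by
      have h1 := hη.det3_ne_zero hN hφ hx
      intro h0
      rcases hη.radial hN hφ hr hsub hx with h | h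
      · rw [h, det3_smul_left, h0, mul_zero] at h1
        exact h1 rfl
      · rw [h, ← neg_smul, det3_smul_left, h0, mul_zero] at h1
        exact h1 rfl
    have hsurj : (fderiv ℝ Φ (x, 1)).range = ⊤ := by
      rw [(hasFDerivAt_cone (z := (x, (1 : ℝ))) hgd).fderiv]
      refine LinearMap.range_eq_top.2 fun v => ?_
      obtain ⟨a, b, e, h⟩ := exists_coeffs_of_det3_ne_zero hdet v
      refine ⟨((a, b), e), ?_⟩
      have h2 := apply_eq_comb (fderiv ℝ g x) (a, b)
      rw [fderiv_sub_const_embed] at h2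
      rw [h, ← h2]
      simp [hg, fderiv_sub_const_embed]
    have hmap := hstrict.map_nhds_eq_of_surj hsurj
    have hΦx : Φ (x, 1) = p - c := by simp [hΦ, hg, hpe]
    rw [hΦx] at hmap
    have hpos : ∀ᶠ z : (ℝ × ℝ) × ℝ in 𝓝 (x, 1), 0 < z.2 :=
      continuousAt_snd.eventually_const_lt one_pos
    have him : Φ '' {z | 0 < z.2} ∈ 𝓝 (p - c) := by
      rw [← hmap]
      exact image_mem_map hpos
    have hsubc : Tendsto (fun q : E3 => q - c) (𝓝 p) (𝓝 (p - c)) :=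
      (continuous_id.sub continuous_const).continuousAt
    filter_upwards [hsubc.eventually him] with q hq hqr
    obtain ⟨⟨y, t⟩, ht, hyt⟩ := hq
    have ht : 0 < t := ht
    have hyt : t • (embed φ y - c) = q - c := hyt
    have ht1 : t = 1 := by
      rw [← hyt, map_smul_eq_mul, hsub _ (φ y).2, Real.norm_eq_abs, abs_of_pos ht] at hqr
      exact mul_right_cancel₀ hr.ne' (hqr.trans (one_mul r).symm)
    rw [ht1, one_smul] at hyt
    rw [← sub_left_injective hyt]
    exact (φ y).2
  by_contra hne
  obtain ⟨q, hq, hqM⟩ := Set.not_subset.1 hne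
  -- An open set of `ℝ³` that meets the sphere exactly in `M`; together with `Mᶜ` it would
  -- disconnect the sphere.
  set u := interior (M ∪ {x | N (x - c) = r}ᶜ)
  have hMu : M ⊆ u := fun p hp => by
    rw [mem_interior_iff_mem_nhds]
    filter_upwards [hopen p hp] with z hz
    by_cases h : N (z - c) = r
    · exact Or.inl (hz h)
    · exact Or.inr h
  obtain ⟨p, hp⟩ := hM.nonempty
  obtain ⟨z, hzS, hzu, hzM⟩ := isPreconnected_sphere hN c hr u Mᶜ isOpen_interior
    hM.isCompact.isClosed.isOpen_compl
    (fun z _ => by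
      by_cases h : z ∈ M
      · exact Or.inl (hMu h)
      · exact Or.inr h)
    ⟨p, hsub p hp, hMu hp⟩ ⟨q, hq, hqM⟩
  rcases interior_subset hzu with h | h
  · exact hzM h
  · exact h hzS

theorem IsBirkhoffGaussMap.lintegral_lt_top (hη : IsBirkhoffGaussMap N M η)
    (hN : IsMinkowskiNorm N) (hM : IsClosedSurface M) :
    ∫⁻ p, ENNReal.ofReal (meanCurvature M η p ^ 2) ∂(areaMeasure M η) < ⊤ := by
  rw [lintegral_eq_setLIntegral hM.measurableSet]
  exact setLIntegral_lt_top_of_isCompact_of_continuousOn hM.isCompact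
    (hM.areaMeasure_lt_top hη.continuousOn) ((hη.continuousOn_meanCurvature hN hM).pow 2)

/-- In the case of equality every point with `H ≠ 0` is umbilic. -/
theorem IsBirkhoffGaussMap.umbilic_of_lintegral_le (hη : IsBirkhoffGaussMap N M η)
    (hN : IsMinkowskiNorm N) (hM : IsClosedSurface M)
    (h : ∫⁻ p, ENNReal.ofReal (meanCurvature M η p ^ 2) ∂(areaMeasure M η) ≤ 3 * ballVolume N)
    {p : E3} (hp : p ∈ M) (hHp : meanCurvature M η p ≠ 0) :
    gaussianCurvature M η p = meanCurvature M η p ^ 2 := by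
  have hH := hη.continuousOn_meanCurvature hN hM
  obtain ⟨P, hPM, hP, hP0, hPV⟩ := hη.exists_elliptic hN hM isOpen_univ
    (Set.inter_univ M).symm hM.isCompact hM.nonempty
  have hFm : AEMeasurable (fun p => ENNReal.ofReal (meanCurvature M η p ^ 2))
      (areaMeasure M η) := by
    rw [← areaMeasure_restrict hM.measurableSet]
    exact (ENNReal.continuous_ofReal.comp_continuousOn (hH.pow 2)).aemeasurable hM.measurableSet
  have hle : P.indicator (fun p => ENNReal.ofReal (gaussianCurvature M η p))
      ≤ᵐ[areaMeasure M η] fun p => ENNReal.ofReal (meanCurvature M η p ^ 2) := by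
    refine Eventually.of_forall (Set.indicator_le fun q hq => ?_)
    exact ENNReal.ofReal_le_ofReal (hη.gaussianCurvature_le_of_mem hN hM (hPM hq))
  have hint : ∫⁻ p, P.indicator (fun p => ENNReal.ofReal (gaussianCurvature M η p)) p
      ∂(areaMeasure M η) = ∫⁻ p in P, ENNReal.ofReal (gaussianCurvature M η p)
        ∂(areaMeasure M η) := lintegral_indicator hP _
  have hae := ae_eq_of_ae_le_of_lintegral_le hle
    ((lintegral_mono_ae hle).trans_lt (hη.lintegral_lt_top hN hM)).ne hFm
    (h.trans (hPV.trans_eq hint.symm))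
  -- Almost everywhere `K = H²` on `P` and `H = 0` off `P`. The product covers both cases in one
  -- equation that extends to all of `M` by continuity.
  have hzero : ∀ᵐ p ∂(areaMeasure M η), p ∈ M →
      meanCurvature M η p * (gaussianCurvature M η p - meanCurvature M η p ^ 2) = 0 := by
    filter_upwards [hae] with q hq hqM
    by_cases hqP : q ∈ P
    · rw [Set.indicator_of_mem hqP,
        ENNReal.ofReal_eq_ofReal_iff (hP0 q hqP) (sq_nonneg _)] at hq
      rw [hq, sub_self, mul_zero]
    · rw [Set.indicator_of_notMem hqP] at hq
      have h1 := ENNReal.ofReal_eq_zero.1 hq.symm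
      have h2 : meanCurvature M η q = 0 := by
        have := le_antisymm h1 (sq_nonneg _)
        simpa using this
      rw [h2, zero_mul]
  have hc := hη.eq_zero_of_ae hN hM
    (hH.mul ((hη.continuousOn_gaussianCurvature hN hM).sub (hH.pow 2))) hzero hp
  exact sub_eq_zero.1 ((mul_eq_zero.1 hc).resolve_left hHp)

/-- The equality case of the Willmore inequality. -/
theorem IsBirkhoffGaussMap.isMinkowskiSphere_of_lintegral_le (hη : IsBirkhoffGaussMap N M η)
    (hN : IsMinkowskiNorm N) (hM : IsClosedSurface M)
    (h : ∫⁻ p, ENNReal.ofReal (meanCurvature M η p ^ 2) ∂(areaMeasure M η)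
      ≤ 3 * ballVolume N) : IsMinkowskiSphere N M := by
  have hH := hη.continuousOn_meanCurvature hN hM
  have hV0 : (0 : ℝ≥0∞) < 3 * ballVolume N :=
    ENNReal.mul_pos (by norm_num) (ballVolume_pos N).ne'
  have hVtop : 3 * ballVolume N < ⊤ := ENNReal.mul_lt_top (by simp) hN.ballVolume_lt_top
  obtain ⟨p₀, hp₀, hh⟩ : ∃ p ∈ M, meanCurvature M η p ≠ 0 := by
    by_contra! hall
    have h1 := hη.le_lintegral hN hM
    rw [lintegral_eq_setLIntegral hM.measurableSet,
      setLIntegral_congr_fun (g := fun _ => 0) hM.measurableSet fun p hp => by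
        simp [hall p hp], lintegral_zero] at h1
    exact hV0.not_ge h1
  set k := meanCurvature M η p₀
  set c₀ := η p₀ - k • p₀
  -- Points where `M` has the same first-order homothety data as at `p₀`. The set is closed by
  -- continuity, and open in `M` because `k ≠ 0` makes nearby points umbilic.
  set C : Set E3 := {p ∈ M | meanCurvature M η p = k ∧ η p - k • p = c₀} with hC
  have hCM : C ⊆ M := fun p hp => hp.1
  have hCcl : IsClosed C := by
    have hc : ContinuousOn (fun p => (meanCurvature M η p, η p - k • p)) M :=
      hH.prodMk (hη.continuousOn.sub (continuous_const_smul k).continuousOn)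
    have := hc.preimage_isClosed_of_isClosed hM.isCompact.isClosed
      (isClosed_singleton (x := (k, c₀)))
    convert this using 1
    ext p
    simp only [hC, Set.mem_ofPred_eq, Set.mem_inter_iff, Set.mem_preimage,
      Set.mem_singleton_iff, Prod.mk.injEq]
  have hCop : ∀ p ∈ C, ∀ᶠ q in 𝓝[M] p, q ∈ C := by
    rintro p ⟨hp, hpk, hpc⟩
    obtain ⟨φ, hφ, hpt⟩ := hM.exists_param ⟨p, hp⟩
    have hx := φ.map_target hpt
    have hpe : embed φ (φ.symm ⟨p, hp⟩) = p := congrArg Subtype.val (φ.right_inv hpt)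
    set x := φ.symm ⟨p, hp⟩
    have hne : ∀ᶠ y in 𝓝 x, meanCurvature M η (embed φ y) ≠ 0 :=
      (hη.contDiffAt_meanCurvature hN hφ hx).continuousAt.eventually_ne (by
        rw [hpe, hpk]
        exact hh)
    have humb := hη.eventually_of_umbilic hN hφ hx (by
      filter_upwards [hne] with y hy
      exact hη.umbilic_of_lintegral_le hN hM h (φ y).2 hy)
    rw [← hpe, ← map_embed_nhds hx, eventually_map]
    filter_upwards [humb] with y hy
    rw [hpe, hpk, hpc] at hy
    exact ⟨(φ y).2, hy⟩
  set O := interior (C ∪ Mᶜ)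
  have hCO : C = M ∩ O := by
    refine Set.Subset.antisymm (fun p hp => ⟨hp.1, ?_⟩) ?_
    · rw [mem_interior_iff_mem_nhds]
      filter_upwards [eventually_nhdsWithin_iff.1 (hCop p hp)] with q hq
      by_cases hqM : q ∈ M
      · exact Or.inl (hq hqM)
      · exact Or.inr hqM
    · rintro p ⟨hpM, hpO⟩
      exact (interior_subset hpO).resolve_right fun hn => hn hpM
  have hCc : IsCompact C := hM.isCompact.of_isClosed_subset hCcl hCM
  have hC0 : C.Nonempty := ⟨p₀, hp₀, rfl, rfl⟩
  -- `C` and a nonempty complement would each carry at least `3 vol(B)`, which is positive and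
  -- finite, exceeding the assumed total.
  have hMC : M ∩ Cᶜ = ∅ := by
    by_contra hne
    have hne := Set.nonempty_iff_ne_empty.2 hne
    have hcomp : IsCompact (M ∩ Cᶜ) := by
      have : M ∩ Cᶜ = M \ O := by
        ext p
        rw [hCO]
        simp only [Set.mem_inter_iff, Set.mem_compl_iff, Set.mem_sdiff]
        tauto
      rw [this]
      exact hM.isCompact.diff isOpen_interior
    have h1 := hη.le_setLIntegral hN hM isOpen_interior hCO hCc hC0
    have h2 := hη.le_setLIntegral hN hM hCcl.isOpen_compl rfl hcomp hne
    have h3 : ∫⁻ p in M, ENNReal.ofReal (meanCurvature M η p ^ 2) ∂(areaMeasure M η)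
        = ∫⁻ p in C, ENNReal.ofReal (meanCurvature M η p ^ 2) ∂(areaMeasure M η)
          + ∫⁻ p in M ∩ Cᶜ, ENNReal.ofReal (meanCurvature M η p ^ 2) ∂(areaMeasure M η) := by
      rw [← lintegral_union hcomp.measurableSet
        (disjoint_compl_right.mono_right Set.inter_subset_right), ← Set.sdiff_eq,
        Set.union_sdiff_cancel hCM]
    rw [lintegral_eq_setLIntegral hM.measurableSet, h3] at h
    have h4 : 3 * ballVolume N + 3 * ballVolume N ≤ 3 * ballVolume N + 0 := by
      rw [add_zero]
      exact (add_le_add h1 h2).trans h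
    exact hV0.not_ge ((ENNReal.add_le_add_iff_left hVtop.ne).1 h4)
  have hall : ∀ p ∈ M, η p - k • p = c₀ := fun p hp => by
    by_contra hne
    have : p ∈ M ∩ Cᶜ := ⟨hp, fun hpC => hne hpC.2.2⟩
    rw [hMC] at this
    exact this
  have hk : 0 < |k| := abs_pos.2 hh
  -- Solving `η p - k • p = c₀` for `p` gives the center and the radius; the absolute value allows
  -- either orientation of `η`.
  refine ⟨-(k⁻¹ • c₀), |k|⁻¹, inv_pos.2 hk,
    hM.eq_sphere hN hη (inv_pos.2 hk) fun p hp => ?_⟩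
  have h1 : p - -(k⁻¹ • c₀) = k⁻¹ • η p := by
    rw [← hall p hp, smul_sub, smul_smul, inv_mul_cancel₀ hh, one_smul]
    abel
  rw [h1, map_smul_eq_mul, hη.norm_eq_one p hp, mul_one, norm_inv, Real.norm_eq_abs]

end Rigidity

end MinkowskiGeometry

end

theorem theorem4p2 (N : Seminorm ℝ E3) (hN : IsMinkowskiNorm N)
    (M : Set E3) (hM : IsClosedSurface M)
    (η : E3 → E3) (hη : IsBirkhoffGaussMap N M η) :
    ∫⁻ p, ENNReal.ofReal (meanCurvature M η p ^ 2) ∂(areaMeasure M η) < ⊤ ∧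
    unitSphereArea N ≤ ∫⁻ p, ENNReal.ofReal (meanCurvature M η p ^ 2) ∂(areaMeasure M η) ∧
    (∫⁻ p, ENNReal.ofReal (meanCurvature M η p ^ 2) ∂(areaMeasure M η) = unitSphereArea N ↔
      IsMinkowskiSphere N M) := by
  refine ⟨hη.lintegral_lt_top hN hM, hN.unitSphereArea_le.trans (hη.le_lintegral hN hM),
    fun h => hη.isMinkowskiSphere_of_lintegral_le hN hM (h.trans_le hN.unitSphereArea_le), ?_⟩
  -- Only here is the exact area of the unit sphere needed; the assumption that the sphere `M` is a
  -- closed surface supplies the parametrizations of `∂B`.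
  rintro ⟨c, r, hr, rfl⟩
  rw [hη.lintegral_eq_of_sphere hN hM hr fun p hp => hp,
    hN.unitSphereArea_eq (hM.unitSphere_of_sphere hr)]
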